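/- Let $T, s$ and $N_1,\dots,N_s$, $K_1,\dots,K_{s-1}$ be nonnegative integers, $N_0=K_0=0$, $M_l=\sum_{k=0}^{l}(N_k+K_k)$, $S=\bigcup_{l=0}^{s-1}\{M_l+1,\dots,M_l+N_{l+1}\}$, $\rho=N_1+\dots+N_s$. Let $\vec\xi(j)=\{\xi_\nu(j)\}_{\nu=1}^{T}$, $j\in\mathbb Z$, be a complex $T$-variate stationary stochastic sequence (zero mean, finite second moments, covariance depending only on the time difference) with spectral density matrix $f=\{f_{\nu\mu}\}$, that is, $f(\lambda)$ is nonnegative definite for almost every $\lambda\in(-\pi,\pi]$, has integrable entries, and $$\mathsf E\,\xi_\nu(n)\overline{\xi_\mu(m)}=\frac1{2\pi}\int_{-\pi}^{\pi}e^{i(n-m)\lambda}f_{\nu\mu}(\lambda)\,d\lambda .$$ Assume the minimality condition: $f(\lambda)$ is invertible for almost every $\lambda$ and $\int_{-\pi}^{\pi}\mathrm{Tr}\,[f(\lambda)^{-1}]\,d\lambda<\infty$. For given vectors $\vec a(j)\in\mathbb C^T$, $j\in S$, consider the functional $$A_s\vec\xi=\sum_{l=0}^{s-1}\ \sum_{j=M_l+1}^{M_l+N_{l+1}}\vec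 a^{\top}(j)\,\vec\xi(j),\qquad A_s(e^{i\lambda})=\sum_{j\in S}\vec a(j)e^{ij\lambda}.$$ Its optimal linear estimate $\widehat{A_s\vec\xi}$ from the observations $\vec\xi(j)$, $j\in\mathbb Z\setminus S$, is the element of the closed linear span $H^-[\vec\xi]$ of $\{\xi_\nu(j): j\notin S,\ 1\le\nu\le T\}$ in $L_2$ of the probability space that minimizes the mean square error $\mathsf E|A_s\vec\xi-\widehat{A_s\vec\xi}|^2$. Let $L_2(f)$ be the space of $\mathbb C^T$-valued functions $\vec b$ on $(-\pi,\pi]$ with $\int_{-\pi}^{\pi}\vec b^{\top}f\,\overline{\vec b}\,d\lambda<\infty$, and let $L_2^{s-}(f)$ be the closed linear span in $L_2(f)$ of the functions $e^{ij\lambda}\delta_\nu$, $j\notin S$, $1\le\nu\le T$, where $\delta_\nu$ is the $\nu$-th unit vector. The spectral characteristic of an estimate is the function $\vec h\in L_2^{s-}(f)$ for which the estimate equals $\int_{-\pi}^{\pi}\vec h^{\top}(e^{i\lambda})Z^{\vec\xi}(d\lambda)$. Here $Z^{\vec\xi}=\{Z_\nu\}_{\nu=1}^T$ is the orthogonal random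 measure of $\vec\xi$: it has mean zero, $\mathsf E Z_\nu(\Delta)\overline{Z_\mu(\Delta')}=\frac1{2\pi}\int_{\Delta\cap\Delta'}f_{\nu\mu}(\lambda)\,d\lambda$, and $\xi_\nu(j)=\int_{-\pi}^{\pi}e^{ij\lambda}Z_\nu(d\lambda)$. Let $\vec a_s\in\mathbb C^{T\rho}$ be the column vector composed of the $\vec a(j)$, $j\in S$, and let $\mathbf B_s$ be the $T\rho\times T\rho$ matrix with $T\times T$ blocks $$B(k,j)=\frac1{2\pi}\int_{-\pi}^{\pi}\left[f(\lambda)^{-1}\right]^{\top}e^{i(j-k)\lambda}\,d\lambda,\qquad k,j\in S .$$ Then the following hold. 1. The matrix $\mathbf B_s$ is invertible. If $\vec c_s=\mathbf B_s^{-1}\vec a_s$ is the vector composed of $\vec c(k)\in\mathbb C^T$, $k\in S$, and $C(k,q)$, $k,q\in S$, are the $T\times T$ blocks of $\mathbf B_s^{-1}$, then $\vec c(k)=\sum_{q\in S}C(k,q)\,\vec a(q)$ for $k\in S$. Put $C_s(e^{i\lambda})=\sum_{k\in S}\vec c(k)e^{ik\lambda}$. 2. The random measure $Z^{\vec\xi}$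 and the optimal linear estimate $\widehat{A_s\vec\xi}$ exist, the latter is unique, and its spectral characteristic $\vec h=\vec h(f)$ is, uniquely up to Lebesgue null sets, $$\vec h^{\top}(f)=A_s^{\top}(e^{i\lambda})-C_s^{\top}(e^{i\lambda})\,[f(\lambda)]^{-1}.$$ 3. Up to Lebesgue null sets, $\vec h(f)$ is also the unique minimizer over $\vec g\in L_2^{s-}(f)$ of $$\Delta(\vec g;f)=\frac1{2\pi}\int_{-\pi}^{\pi}[A_s(e^{i\lambda})-\vec g(\lambda)]^{\top}f(\lambda)\,\overline{[A_s(e^{i\lambda})-\vec g(\lambda)]}\,d\lambda .$$ 4. The mean square error of the optimal estimate is $$\mathsf E\,|A_s\vec\xi-\widehat{A_s\vec\xi}|^2=\Delta(\vec h(f);f)=\langle\vec c_s,\vec a_s\rangle ,$$ where $\langle x,y\rangle=\sum_i x_i\overline{y_i}$. -/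

import Mathlib

open MeasureTheory Set Filter Topology
open scoped Real ENNReal Matrix ComplexOrder ComplexConjugate

namespace Interp

noncomputable section

/-! ### The set of missing observations -/

/-- `M_l = ∑_{k=0}^{l} (N_k + K_k)`. -/
def blockStart (N K : ℕ → ℕ) (l : ℕ) : ℕ := ∑ k ∈ Finset.range (l + 1), (N k + K k)

/-- The `l`-th block of missing points, `{M_l + 1, …, M_l + N_{l+1}}`. -/
def block (N K : ℕ → ℕ) (l : ℕ) : Finset ℤ :=
  Finset.Icc ((blockStart N K l : ℤ) + 1) ((blockStart N K l : ℤ) + (N (l + 1) : ℤ))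

/-- `S = ⋃_{l=0}^{s-1} {M_l + 1, …, M_l + N_{l+1}}`. -/
def missingSet (s : ℕ) (N K : ℕ → ℕ) : Set ℤ := {j | ∃ l < s, j ∈ block N K l}

/-- The `ρ = N_1 + … + N_s` positions `(l, j)`: a block number `l = 0, …, s-1` together with a point
`j` of the `l`-th block.  A sum over `MissIdx s N K` is the double sum
`∑_{l=0}^{s-1} ∑_{j=M_l+1}^{M_l+N_{l+1}}`. -/
abbrev MissIdx (s : ℕ) (N K : ℕ → ℕ) : Type := Σ l : Fin s, {j : ℤ // j ∈ block N K l}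

/-- The time point `j` of the position `(l, j)`. -/
abbrev MissIdx.time {s : ℕ} {N K : ℕ → ℕ} (p : MissIdx s N K) : ℤ := p.2.1

/-! ### Frequency domain -/

/-- Lebesgue measure on `(-π, π]`. -/
def freqMeasure : Measure ℝ := volume.restrict (Ioc (-π) π)

/-- The function `x ↦ e^{ijx} δ_ν`. -/
def expVec {T : ℕ} (j : ℤ) (ν : Fin T) (x : ℝ) : Fin T → ℂ :=
  Pi.single ν (Complex.exp (Complex.I * j * x))

/-- `f` is a matrix valued density on `(-π, π]`: nonnegative definite, with integrable entries. -/
structure IsMatrixDensity {T : ℕ} (f : ℝ → Matrix (Fin T) (Fin T) ℂ) : Prop where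
  integrable : ∀ ν μ, Integrable (fun x => f x ν μ) freqMeasure
  posSemidef : ∀ᵐ x ∂freqMeasure, (f x).PosSemidef

/-- The minimality condition `∫ Tr [f(x)⁻¹] dx < ∞`; it includes that `f(x)` is invertible for
almost every `x`. -/
structure MinimalityCondition {T : ℕ} (f : ℝ → Matrix (Fin T) (Fin T) ℂ) : Prop where
  isUnit_det : ∀ᵐ x ∂freqMeasure, IsUnit (f x).det
  integrable_trace : Integrable (fun x => ((f x)⁻¹).trace) freqMeasure

/-- The integrand `bᵀ(x) f(x) conj (b(x))`, which is real and nonnegative where `f(x)` is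
nonnegative definite. -/
def quadForm {T : ℕ} (f : ℝ → Matrix (Fin T) (Fin T) ℂ) (b : ℝ → Fin T → ℂ) (x : ℝ) : ℝ :=
  (b x ⬝ᵥ (f x *ᵥ star (b x))).re

/-- `∫_{-π}^{π} bᵀ(x) f(x) conj (b(x)) dx`, the squared norm of `L₂(f)`. -/
def energy {T : ℕ} (f : ℝ → Matrix (Fin T) (Fin T) ℂ) (b : ℝ → Fin T → ℂ) : ℝ :=
  ∫ x, quadForm f b x ∂freqMeasure

/-- `b ∈ L₂(f)`. -/
structure MemL2 {T : ℕ} (f : ℝ → Matrix (Fin T) (Fin T) ℂ) (b : ℝ → Fin T → ℂ) : Prop where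
  aestronglyMeasurable : AEStronglyMeasurable b freqMeasure
  integrable : Integrable (quadForm f b) freqMeasure

/-- The subspace of `L₂(f)` generated by the functions `e^{ijx} δ_ν`, `j ∉ S`: the closure in
`L₂(f)` of their linear span. -/
def L2minus {T : ℕ} (f : ℝ → Matrix (Fin T) (Fin T) ℂ) (S : Set ℤ) : Set (ℝ → Fin T → ℂ) :=
  {h | MemL2 f h ∧ ∀ ε > 0,
    ∃ p ∈ Submodule.span ℂ {b : ℝ → Fin T → ℂ | ∃ j, j ∉ S ∧ ∃ ν, b = expVec j ν},
      energy f (h - p) < ε}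

/-- The mean square error
`Δ(h; f) = (1/2π) ∫ [A(x) - h(x)]ᵀ f(x) conj [A(x) - h(x)] dx`. -/
def meanSquareError {T : ℕ} (f : ℝ → Matrix (Fin T) (Fin T) ℂ) (A h : ℝ → Fin T → ℂ) : ℝ :=
  (2 * π)⁻¹ * energy f (A - h)

/-! ### Stationary sequences and their spectral random measures -/

section Probability

variable {Ω : Type*} [MeasurableSpace Ω]

/-- A `T`-variate stationary sequence: zero mean, finite second moments, and a covariance
`E ξ_ν(n) conj (ξ_μ(m))` that depends on `n - m` only. -/
structure IsStationarySeq {T : ℕ} (P : Measure Ω) (ξ : ℤ → Fin T → Ω → ℂ) : Prop where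
  memLp : ∀ n ν, MemLp (ξ n ν) 2 P
  mean_zero : ∀ n ν, ∫ ω, ξ n ν ω ∂P = 0
  stationary : ∀ n m k ν μ,
    ∫ ω, ξ (n + k) ν ω * conj (ξ (m + k) μ ω) ∂P = ∫ ω, ξ n ν ω * conj (ξ m μ ω) ∂P

/-- `f` is the spectral density matrix of `ξ`:
`E ξ_ν(n) conj (ξ_μ(m)) = (1/2π) ∫ e^{i(n-m)x} f_{νμ}(x) dx`. -/
structure HasSpectralDensity {T : ℕ} (P : Measure Ω) (ξ : ℤ → Fin T → Ω → ℂ)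
    (f : ℝ → Matrix (Fin T) (Fin T) ℂ) : Prop where
  isMatrixDensity : IsMatrixDensity f
  covariance : ∀ n m ν μ, ∫ ω, ξ n ν ω * conj (ξ m μ ω) ∂P =
    (2 * π : ℂ)⁻¹ * ∫ x, Complex.exp (Complex.I * ((n - m : ℤ) : ℂ) * x) * f x ν μ ∂freqMeasure

/-- The integral `∫ φᵀ(x) Z(dx)` of a simple function `φ`, that is
`∑_b ∑_ν b_ν Z_ν({φ = b})`. -/
def simpleIntegral {T : ℕ} {P : Measure Ω} (Z : Set ℝ → Fin T → Lp ℂ 2 P)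
    (φ : SimpleFunc ℝ (Fin T → ℂ)) : Lp ℂ 2 P :=
  ∑ b ∈ φ.range, ∑ ν, b ν • Z (φ ⁻¹' {b} ∩ Ioc (-π) π) ν

/-- `Y = ∫ gᵀ(x) Z(dx)` for `g ∈ L₂(f)`: `Y` is the mean square limit of the integrals of simple
functions that converge to `g` in `L₂(f)`. -/
def IsStochIntegral {T : ℕ} {P : Measure Ω} (f : ℝ → Matrix (Fin T) (Fin T) ℂ)
    (Z : Set ℝ → Fin T → Lp ℂ 2 P) (g : ℝ → Fin T → ℂ) (Y : Lp ℂ 2 P) : Prop :=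
  MemL2 f g ∧ ∃ φ : ℕ → SimpleFunc ℝ (Fin T → ℂ),
    Tendsto (fun n => energy f (g - ⇑(φ n))) atTop (𝓝 0) ∧
    Tendsto (fun n => simpleIntegral Z (φ n)) atTop (𝓝 Y)

/-- `Z = (Z_ν)` is the orthogonal random measure on `(-π, π]` of the stationary sequence `ξ` with
spectral density matrix `f`: its values have mean zero,
`E Z_ν(D) conj (Z_μ(D')) = (1/2π) ∫_{D ∩ D'} f_{νμ}(x) dx`, and
`ξ_ν(j) = ∫ e^{ijx} Z_ν(dx)` almost surely. -/
structure IsSpectralRandomMeasure {T : ℕ} (P : Measure Ω) (ξ : ℤ → Fin T → Ω → ℂ)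
    (f : ℝ → Matrix (Fin T) (Fin T) ℂ) (Z : Set ℝ → Fin T → Lp ℂ 2 P) : Prop where
  mean_zero : ∀ D, MeasurableSet D → D ⊆ Ioc (-π) π → ∀ ν, ∫ ω, Z D ν ω ∂P = 0
  covariance : ∀ D D', MeasurableSet D → MeasurableSet D' → D ⊆ Ioc (-π) π → D' ⊆ Ioc (-π) π →
    ∀ ν μ, ∫ ω, Z D ν ω * conj (Z D' μ ω) ∂P = (2 * π : ℂ)⁻¹ * ∫ x in D ∩ D', f x ν μ
  representation : ∀ j ν, ∃ X : Lp ℂ 2 P, X =ᵐ[P] ξ j ν ∧ IsStochIntegral f Z (expVec j ν) X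

/-- `H⁻[ξ]`: the closed subspace of `L₂(P)` generated by the values `ξ_ν(j)`, `j ∉ S`. -/
def observedSpace {T : ℕ} (P : Measure Ω) (ξ : ℤ → Fin T → Ω → ℂ) (S : Set ℤ) :
    Submodule ℂ (Lp ℂ 2 P) :=
  (Submodule.span ℂ {Y : Lp ℂ 2 P | ∃ j, j ∉ S ∧ ∃ ν, Y =ᵐ[P] ξ j ν}).topologicalClosure

/-- `Y` is an optimal linear estimate of `X` from the values `ξ_ν(j)`, `j ∉ S`: it minimizes the
mean square error `E|X - W|²` over `W ∈ H⁻[ξ]`. -/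
def IsOptimalEstimate {T : ℕ} (P : Measure Ω) (ξ : ℤ → Fin T → Ω → ℂ) (S : Set ℤ) (X : Ω → ℂ)
    (Y : Lp ℂ 2 P) : Prop :=
  Y ∈ observedSpace P ξ S ∧
    ∀ W ∈ observedSpace P ξ S, ∫ ω, ‖X ω - Y ω‖ ^ 2 ∂P ≤ ∫ ω, ‖X ω - W ω‖ ^ 2 ∂P

/-- `h` is a spectral characteristic of the linear estimate `Y`: `h ∈ L₂^{s-}(f)` and
`Y = ∫ hᵀ(x) Z(dx)`. -/
def IsSpectralCharacteristic {T : ℕ} {P : Measure Ω} (f : ℝ → Matrix (Fin T) (Fin T) ℂ)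
    (S : Set ℤ) (Z : Set ℝ → Fin T → Lp ℂ 2 P) (Y : Lp ℂ 2 P) (h : ℝ → Fin T → ℂ) : Prop :=
  h ∈ L2minus f S ∧ IsStochIntegral f Z h Y

/-- The functional `A_s ξ = ∑_{l} ∑_{j} aᵀ(j) ξ(j)`. -/
def functional {T : ℕ} (s : ℕ) (N K : ℕ → ℕ) (a : ℤ → Fin T → ℂ) (ξ : ℤ → Fin T → Ω → ℂ)
    (ω : Ω) : ℂ :=
  ∑ p : MissIdx s N K, a p.time ⬝ᵥ fun ν => ξ p.time ν ω

end Probability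

/-! ### The objects in the formulas -/

/-- The trigonometric polynomial `∑_{l} ∑_{j} v(j) e^{ijx}` whose coefficients are the components of
a vector `v` of length `Tρ`. -/
def trigPoly {T s : ℕ} {N K : ℕ → ℕ} (v : MissIdx s N K × Fin T → ℂ) (x : ℝ) : Fin T → ℂ :=
  fun ν => ∑ p : MissIdx s N K, v (p, ν) * Complex.exp (Complex.I * p.time * x)

/-- The column vector `a_s` of length `Tρ`. -/
def aVec {T : ℕ} (s : ℕ) (N K : ℕ → ℕ) (a : ℤ → Fin T → ℂ) : MissIdx s N K × Fin T → ℂ :=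
  fun q => a q.1.time q.2

/-- The `Tρ × Tρ` matrix `B_s`, whose `T × T` blocks are
`B(k, j) = (1/2π) ∫ [f(x)⁻¹]ᵀ e^{i(j-k)x} dx`. -/
def BMat {T : ℕ} (s : ℕ) (N K : ℕ → ℕ) (f : ℝ → Matrix (Fin T) (Fin T) ℂ) :
    Matrix (MissIdx s N K × Fin T) (MissIdx s N K × Fin T) ℂ :=
  Matrix.of fun k j => (2 * π : ℂ)⁻¹ *
    ∫ x, ((f x)⁻¹)ᵀ k.2 j.2 *
      Complex.exp (Complex.I * ((j.1.time - k.1.time : ℤ) : ℂ) * x) ∂freqMeasure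

/-- The vector `c_s = B_s⁻¹ a_s`. -/
def cVec {T : ℕ} (s : ℕ) (N K : ℕ → ℕ) (f : ℝ → Matrix (Fin T) (Fin T) ℂ)
    (a : ℤ → Fin T → ℂ) : MissIdx s N K × Fin T → ℂ :=
  (BMat s N K f)⁻¹ *ᵥ aVec s N K a

/-- The `T × T` block `C(k, q)` of `B_s⁻¹`. -/
def CBlock {T : ℕ} (s : ℕ) (N K : ℕ → ℕ) (f : ℝ → Matrix (Fin T) (Fin T) ℂ)
    (k q : MissIdx s N K) : Matrix (Fin T) (Fin T) ℂ :=
  Matrix.of fun ν μ => (BMat s N K f)⁻¹ (k, ν) (q, μ)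

/-- The function `h` with `hᵀ = A_sᵀ - C_sᵀ f⁻¹`. -/
def specChar {T : ℕ} (s : ℕ) (N K : ℕ → ℕ) (f : ℝ → Matrix (Fin T) (Fin T) ℂ)
    (a : ℤ → Fin T → ℂ) (x : ℝ) : Fin T → ℂ :=
  trigPoly (aVec s N K a) x - trigPoly (cVec s N K f a) x ᵥ* (f x)⁻¹

end

end Interp

open Interp

namespace Interp

/-! The problem is an orthogonal projection, computed in the frequency domain and carried to `L₂(P)`
by an isometry.

Write `f = 2π r rᴴ` with `r` invertible almost everywhere (`exists_factorization`). Then `b ↦ rᵀ b`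
realizes `L₂(f)`, with inner product scaled by `1/(2π)`, inside the ordinary `L²` space of
`ℂ^T`-valued functions. The minimality condition puts the functions `e^{ijx} (f⁻¹)ᵀ δ_ν` in `L₂(f)`.
Pairing with one of them cancels `f` and leaves an ordinary Fourier coefficient, so these functions
are biorthogonal to the exponentials (`inner_expVec_dualVec`), and their Gram matrix over the
missing points is `B_s` (`inner_dualVec_dualVec`). Biorthogonality makes the finite dual family
independent, hence `B_s` is invertible.

The exponentials are total, so the orthogonal complement of the observed ones is exactly the span of
the dual functions with index in `S` (`eq_sum_dualVec_of_mem_orthogonal`). Therefore `A_s - h` must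
be a combination `∑ c_q dual_q`, and orthogonality of `h` to every dual function reads `B_s c =
a_s`. The squared error is then the Gram form `c* B_s c = c* a_s`, a real number and hence equal to
`⟨c_s, a_s⟩`; uniqueness is Pythagoras.

For the probabilistic part, the exponentials and the variables `ξ_ν(j)` have the same Gram matrix,
which gives an isometry `Φ` taking one family to the other (`exists_spectralIsometry`). Every
spectral random measure must be the image under `Φ` of the indicators (`spectralRandomMeasure_eq`),
so stochastic integration is `Φ` itself (`isStochIntegral_iff`), and the projection found above
transfers verbatim. -/

instance : IsFiniteMeasure freqMeasure := by
  unfold freqMeasure; infer_instance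

/-! ### Fourier coefficients -/

lemma norm_exp_I_int (j : ℤ) (x : ℝ) : ‖Complex.exp (Complex.I * j * x)‖ = 1 := by
  rw [show Complex.I * j * x = ((j * x : ℝ) : ℂ) * Complex.I by push_cast; ring]
  exact Complex.norm_exp_ofReal_mul_I _

lemma integral_exp_freqMeasure (j : ℤ) :
    ∫ x, Complex.exp (Complex.I * j * x) ∂freqMeasure = if j = 0 then (2 * π : ℂ) else 0 := by
  rw [freqMeasure, ← intervalIntegral.integral_of_le (by linarith [Real.pi_pos])]
  split_ifs with hj
  · subst hj
    simp only [Int.cast_zero, mul_zero, zero_mul, Complex.exp_zero, intervalIntegral.integral_const]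
    rw [Complex.real_smul]; push_cast; ring
  · have hj' : Complex.I * (j : ℂ) ≠ 0 := by simp [hj]
    rw [integral_exp_mul_complex hj', div_eq_zero_iff]
    left
    rw [sub_eq_zero, Complex.exp_eq_exp_iff_exists_int]
    exact ⟨j, by push_cast; ring⟩

/-- An integrable function whose Fourier coefficients vanish is zero almost everywhere. -/
lemma ae_eq_zero_of_fourier {F : ℝ → ℂ} (hF : Integrable F freqMeasure)
    (h : ∀ j : ℤ, ∫ x, Complex.exp (Complex.I * j * x) * F x ∂freqMeasure = 0) :
    ∀ᵐ x ∂freqMeasure, F x = 0 := by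
  have : Fact (0 < 2 * π) := ⟨Real.two_pi_pos⟩
  have hcont (φ : C(AddCircle (2 * π), ℂ)) : Continuous fun x : ℝ => φ (x : AddCircle (2 * π)) :=
    φ.continuous.comp (AddCircle.continuous_mk' _)
  have hint (φ : C(AddCircle (2 * π), ℂ)) :
      Integrable (fun x : ℝ => φ (x : AddCircle (2 * π)) * F x) freqMeasure :=
    hF.bdd_mul (c := ‖φ‖) (hcont φ).aestronglyMeasurable
      (Eventually.of_forall fun x => φ.norm_coe_le_norm _)
  -- Integration against `F` is a bounded functional on continuous functions of the circle; it kills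
  -- the exponentials, whose span is uniformly dense.
  let L : C(AddCircle (2 * π), ℂ) →L[ℂ] ℂ := LinearMap.mkContinuous
    { toFun := fun φ => ∫ x : ℝ, φ (x : AddCircle (2 * π)) * F x ∂freqMeasure
      map_add' := fun φ ψ => by
        rw [← integral_add (hint φ) (hint ψ)]
        simp [add_mul]
      map_smul' := fun c φ => by
        rw [RingHom.id_apply, smul_eq_mul, ← integral_const_mul]
        simp [mul_assoc] }
    (∫ x, ‖F x‖ ∂freqMeasure) (fun φ => by
      refine (norm_integral_le_integral_norm _).trans ?_
      rw [mul_comm (∫ x, ‖F x‖ ∂freqMeasure), ← integral_const_mul]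
      refine integral_mono (hint φ).norm (hF.norm.const_mul _) fun x => ?_
      simp only [norm_mul]
      gcongr
      exact φ.norm_coe_le_norm _)
  have hL : ∀ φ, L φ = 0 := by
    have h1 : Submodule.span ℂ (range <| @fourier (2 * π)) ≤ L.ker := by
      rw [Submodule.span_le]
      rintro _ ⟨j, rfl⟩
      refine (Eq.trans ?_ (h j) : L (fourier j) = 0)
      refine integral_congr_ae (Eventually.of_forall fun x => ?_)
      simp only [fourier_coe_apply]
      congr 2
      have : (π : ℂ) ≠ 0 := by exact_mod_cast Real.pi_ne_zero
      push_cast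
      field_simp
    have h2 := Submodule.topologicalClosure_minimal _ h1 L.isClosed_ker
    rw [span_fourier_closure_eq_top] at h2
    exact fun φ => h2 (Submodule.mem_top : φ ∈ ⊤)
  have hIoo : ∀ᵐ x ∂freqMeasure, x ∈ Ioo (-π) π → F x = 0 := by
    refine isOpen_Ioo.ae_eq_zero_of_integral_contDiff_smul_eq_zero
      (hF.locallyIntegrable.locallyIntegrableOn _) ?_
    intro g hg _ hsupp
    have h0 (x : ℝ) (hx : x ∉ Ioo (-π) π) : g x = 0 := by
      by_contra hne
      exact hx (hsupp (subset_tsupport _ hne))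
    -- A test function supported in the open interval vanishes at both endpoints, so it descends to
    -- the circle.
    have hc : Continuous (AddCircle.liftIoc (2 * π) (-π) fun x => (g x : ℂ)) := by
      refine AddCircle.liftIoc_continuous ?_ ?_
      · rw [h0 (-π) (by simp), h0 (-π + 2 * π) (by
          simp only [mem_Ioo, not_and, not_lt]
          intro; linarith)]
      · exact (Complex.continuous_ofReal.comp hg.continuous).continuousOn
    rw [← hL ⟨_, hc⟩]
    refine setIntegral_congr_fun measurableSet_Ioc fun x hx => ?_
    have hx' : x ∈ Ioc (-π) (-π + 2 * π) := ⟨hx.1, by linarith [hx.2]⟩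
    simp only [ContinuousMap.coe_mk, AddCircle.liftIoc_coe_apply hx']
    exact Complex.real_smul
  have hne : ∀ᵐ x ∂freqMeasure, x ≠ π :=
    ae_restrict_of_ae (by simp [ae_iff])
  filter_upwards [hIoo, hne, ae_restrict_mem measurableSet_Ioc] with x h1 h2 h3
  exact h1 ⟨h3.1, lt_of_le_of_ne h3.2 h2⟩

/-! ### A measurable factorization of the density -/

section Sqrt

open scoped MatrixOrder Matrix.Norms.L2Operator

lemma aestronglyMeasurable_matrix {T : ℕ} {f : ℝ → Matrix (Fin T) (Fin T) ℂ} {μ : Measure ℝ}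
    (h : ∀ i j, AEStronglyMeasurable (fun x => f x i j) μ) : AEStronglyMeasurable f μ := by
  have : AEMeasurable (fun x i j => f x i j) μ :=
    aemeasurable_pi_iff.2 fun i => aemeasurable_pi_iff.2 fun j => (h i j).aemeasurable
  exact this.aestronglyMeasurable

/-- The square root is continuous on nonnegative matrices. Inserting the absolute value, harmless
where `f` is nonnegative definite, gives a globally continuous map, and hence a measurable root of
`f`. -/
lemma continuous_sqrt_abs {T : ℕ} :
    Continuous (fun A : Matrix (Fin T) (Fin T) ℂ => CFC.sqrt (CFC.abs A)) :=
  CFC.continuousOn_sqrt.comp_continuous CFC.continuous_abs fun A => CFC.abs_nonneg A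

lemma aestronglyMeasurable_entry {T : ℕ} {f : ℝ → Matrix (Fin T) (Fin T) ℂ} {μ : Measure ℝ}
    (h : AEStronglyMeasurable f μ) (i j : Fin T) : AEStronglyMeasurable (fun x => f x i j) μ :=
  (show Continuous fun A : Matrix (Fin T) (Fin T) ℂ => A i j by fun_prop).comp_aestronglyMeasurable h

lemma exists_sqrt {T : ℕ} {f : ℝ → Matrix (Fin T) (Fin T) ℂ} {μ : Measure ℝ}
    (hm : ∀ i j, AEStronglyMeasurable (fun x => f x i j) μ)
    (hp : ∀ᵐ x ∂μ, (f x).PosSemidef) :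
    ∃ r : ℝ → Matrix (Fin T) (Fin T) ℂ, (∀ i j, AEStronglyMeasurable (fun x => r x i j) μ) ∧
      ∀ᵐ x ∂μ, r x * (r x)ᴴ = f x := by
  refine ⟨fun x => CFC.sqrt (CFC.abs (f x)), fun i j => aestronglyMeasurable_entry
    (continuous_sqrt_abs.comp_aestronglyMeasurable (aestronglyMeasurable_matrix hm)) i j, ?_⟩
  filter_upwards [hp] with x hx
  have h0 : 0 ≤ f x := hx.nonneg
  have h1 : (CFC.sqrt (f x))ᴴ = CFC.sqrt (f x) :=
    (Matrix.nonneg_iff_posSemidef.1 (CFC.sqrt_nonneg (f x))).isHermitian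
  rw [CFC.abs_of_nonneg _ h0, h1, CFC.sqrt_mul_sqrt_self _ h0]

end Sqrt

lemma aestronglyMeasurable_inv_entry {T : ℕ} {r : ℝ → Matrix (Fin T) (Fin T) ℂ} {μ : Measure ℝ}
    (hm : ∀ i j, AEStronglyMeasurable (fun x => r x i j) μ) (i j : Fin T) :
    AEStronglyMeasurable (fun x => (r x)⁻¹ i j) μ := by
  have hr := aestronglyMeasurable_matrix hm
  have hdet : AEStronglyMeasurable (fun x => (r x).det) μ :=
    (show Continuous fun A : Matrix (Fin T) (Fin T) ℂ => A.det from
      continuous_id.matrix_det).comp_aestronglyMeasurable hr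
  have hadj : AEStronglyMeasurable (fun x => (r x).adjugate i j) μ :=
    (show Continuous fun A : Matrix (Fin T) (Fin T) ℂ => A.adjugate i j from
      continuous_id.matrix_adjugate.matrix_elem i j).comp_aestronglyMeasurable hr
  have := hdet.aemeasurable.inv.aestronglyMeasurable.mul hadj
  refine this.congr (Eventually.of_forall fun x => ?_)
  simp [Matrix.inv_def]

/-- A factorization `f = 2π r rᴴ` of the density, with square integrable `r` and `w = r⁻¹`. -/
structure Factorization {T : ℕ} (f : ℝ → Matrix (Fin T) (Fin T) ℂ)
    (r w : ℝ → Matrix (Fin T) (Fin T) ℂ) : Prop where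
  memLp : ∀ i j, MemLp (fun x => r x i j) 2 freqMeasure
  memLp_inv : ∀ i j, MemLp (fun x => w x i j) 2 freqMeasure
  eq : ∀ᵐ x ∂freqMeasure, f x = (2 * π : ℂ) • (r x * (r x)ᴴ)
  mul_inv : ∀ᵐ x ∂freqMeasure, r x * w x = 1
  inv_eq : ∀ᵐ x ∂freqMeasure, (f x)⁻¹ = (2 * π : ℂ)⁻¹ • ((w x)ᴴ * w x)
  isUnit_det : ∀ᵐ x ∂freqMeasure, IsUnit (f x).det

lemma two_pi_ne_zero : (2 * π : ℂ) ≠ 0 := by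
  exact_mod_cast Real.two_pi_pos.ne'

/-- Take `r` to be the root of `f / (2π)`. Integrability of `f i i = 2π ∑ₖ |r i k|²` bounds the
entries of `r`; that of `Tr f⁻¹`, which is `1/(2π)` times the sum of all `|w l k|²`, bounds the
entries of `w = r⁻¹`. -/
lemma exists_factorization {T : ℕ} {f : ℝ → Matrix (Fin T) (Fin T) ℂ} (hf : IsMatrixDensity f)
    (hmin : MinimalityCondition f) : ∃ r w, Factorization f r w := by
  obtain ⟨r, hrm, hr⟩ := exists_sqrt (f := fun x => (2 * π : ℂ)⁻¹ • f x) (μ := freqMeasure)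
    (fun i j => (hf.integrable i j).aestronglyMeasurable.const_smul (2 * π : ℂ)⁻¹)
    (by
      filter_upwards [hf.posSemidef] with x hx
      refine hx.smul ?_
      have : (0 : ℝ) ≤ (2 * π)⁻¹ := by positivity
      exact_mod_cast this)
  have hwm := aestronglyMeasurable_inv_entry hrm
  have heq : ∀ᵐ x ∂freqMeasure, f x = (2 * π : ℂ) • (r x * (r x)ᴴ) := by
    filter_upwards [hr] with x hx
    rw [hx, smul_smul, mul_inv_cancel₀ two_pi_ne_zero, one_smul]
  have hunit : ∀ᵐ x ∂freqMeasure, IsUnit (r x).det := by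
    filter_upwards [heq, hmin.isUnit_det] with x hx hdet
    rw [hx, Matrix.det_smul, Matrix.det_mul] at hdet
    exact isUnit_of_mul_isUnit_left (isUnit_of_mul_isUnit_right hdet)
  have hinv : ∀ᵐ x ∂freqMeasure, (f x)⁻¹ = (2 * π : ℂ)⁻¹ • (((r x)⁻¹)ᴴ * (r x)⁻¹) := by
    filter_upwards [heq, hunit] with x hx hu
    refine Matrix.inv_eq_right_inv ?_
    have h1 : (r x)ᴴ * ((r x)⁻¹)ᴴ = 1 := by
      rw [← Matrix.conjTranspose_mul, Matrix.nonsing_inv_mul _ hu, Matrix.conjTranspose_one]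
    rw [hx, Matrix.smul_mul, Matrix.mul_smul, smul_smul, mul_inv_cancel₀ two_pi_ne_zero, one_smul,
      Matrix.mul_assoc, ← Matrix.mul_assoc _ _ ((r x)⁻¹), h1, Matrix.one_mul,
      Matrix.mul_nonsing_inv _ hu]
  refine ⟨r, fun x => (r x)⁻¹, ⟨fun i j => ?_, fun i j => ?_, heq, ?_, hinv, hmin.isUnit_det⟩⟩
  · rw [memLp_two_iff_integrable_sq_norm (hrm i j)]
    refine Integrable.mono' (((hf.integrable i i).norm).const_mul (2 * π)⁻¹)
      ((hrm i j).norm.pow 2) ?_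
    filter_upwards [heq] with x hx
    have h1 : f x i i = ((2 * π * ∑ k, ‖r x i k‖ ^ 2 : ℝ) : ℂ) := by
      rw [hx]
      simp [Matrix.mul_apply, Complex.mul_conj']
    have h2 (S : ℝ) (hS : 0 ≤ S) : (2 * π)⁻¹ * ‖((2 * π * S : ℝ) : ℂ)‖ = S := by
      rw [Complex.norm_real, Real.norm_of_nonneg (by positivity), ← mul_assoc,
        inv_mul_cancel₀ Real.two_pi_pos.ne', one_mul]
    rw [h1, h2 _ (Finset.sum_nonneg fun k _ => by positivity), norm_pow, norm_norm]
    exact Finset.single_le_sum (f := fun k => ‖r x i k‖ ^ 2) (fun k _ => by positivity)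
      (Finset.mem_univ j)
  · rw [memLp_two_iff_integrable_sq_norm (hwm i j)]
    refine Integrable.mono' ((hmin.integrable_trace.norm).const_mul (2 * π))
      ((hwm i j).norm.pow 2) ?_
    filter_upwards [hinv] with x hx
    have h1 : ((f x)⁻¹).trace = (((2 * π)⁻¹ * ∑ k, ∑ l, ‖(r x)⁻¹ l k‖ ^ 2 : ℝ) : ℂ) := by
      rw [hx]
      simp [Matrix.trace, Matrix.mul_apply, Complex.conj_mul', Finset.mul_sum]
    have h2 (S : ℝ) (hS : 0 ≤ S) : 2 * π * ‖(((2 * π)⁻¹ * S : ℝ) : ℂ)‖ = S := by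
      rw [Complex.norm_real, Real.norm_of_nonneg (by positivity), ← mul_assoc,
        mul_inv_cancel₀ Real.two_pi_pos.ne', one_mul]
    rw [h1, h2 _ (Finset.sum_nonneg fun k _ => Finset.sum_nonneg fun l _ => by positivity),
      norm_pow, norm_norm]
    exact (Finset.single_le_sum (f := fun l => ‖(r x)⁻¹ l j‖ ^ 2) (fun k _ => by positivity)
      (Finset.mem_univ i)).trans (Finset.single_le_sum
        (f := fun k => ∑ l, ‖(r x)⁻¹ l k‖ ^ 2) (fun k _ => by positivity) (Finset.mem_univ j))
  · filter_upwards [hunit] with x hx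
    exact Matrix.mul_nonsing_inv _ hx

end Interp

namespace Interp

noncomputable section

/-! ### Embedding of `L₂(f)` into a Lebesgue space -/

/-- The Hilbert space of square integrable `ℂ^T`-valued functions on `(-π, π]`. -/
abbrev FreqSpace (T : ℕ) : Type := Lp (EuclideanSpace ℂ (Fin T)) 2 freqMeasure

/-- The function `rᵀ b`. -/
def weighted {T : ℕ} (r : ℝ → Matrix (Fin T) (Fin T) ℂ) (b : ℝ → Fin T → ℂ) (x : ℝ) :
    EuclideanSpace ℂ (Fin T) :=
  WithLp.toLp 2 (b x ᵥ* r x)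

open Classical in
/-- The class of `rᵀ b`, or zero if `rᵀ b` is not square integrable. -/
def embed {T : ℕ} (r : ℝ → Matrix (Fin T) (Fin T) ℂ) (b : ℝ → Fin T → ℂ) : FreqSpace T :=
  if h : MemLp (weighted r b) 2 freqMeasure then h.toLp else 0

section

variable {T : ℕ} {f r w : ℝ → Matrix (Fin T) (Fin T) ℂ} {b c : ℝ → Fin T → ℂ}

lemma weighted_add : weighted r (b + c) = weighted r b + weighted r c := by
  ext x i; simp [weighted, Matrix.add_vecMul]

lemma weighted_sub : weighted r (b - c) = weighted r b - weighted r c := by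
  ext x i; simp [weighted, Matrix.sub_vecMul]

lemma weighted_smul (k : ℂ) : weighted r (k • b) = k • weighted r b := by
  ext x i; simp [weighted, Matrix.smul_vecMul]

lemma aestronglyMeasurable_coord (hb : AEStronglyMeasurable b freqMeasure) (i : Fin T) :
    AEStronglyMeasurable (fun x => b x i) freqMeasure :=
  (continuous_apply i).comp_aestronglyMeasurable hb

lemma aestronglyMeasurable_vec (hb : ∀ i, AEStronglyMeasurable (fun x => b x i) freqMeasure) :
    AEStronglyMeasurable b freqMeasure :=
  (aemeasurable_pi_iff.2 fun i => (hb i).aemeasurable).aestronglyMeasurable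

namespace Factorization

/-- The factor `2π` in the factorization produces the normalization of the covariance. Since `inner`
is conjugate linear in its first argument, `b` and `c` change places. -/
lemma inner_weighted (F : Factorization f r w) : ∀ᵐ x ∂freqMeasure,
    ∀ b c : ℝ → Fin T → ℂ, inner ℂ (weighted r b x) (weighted r c x) =
      (2 * π : ℂ)⁻¹ * (c x ⬝ᵥ (f x *ᵥ star (b x))) := by
  filter_upwards [F.eq] with x hx b c
  rw [hx, Matrix.smul_mulVec, dotProduct_smul, smul_eq_mul, ← mul_assoc,
    inv_mul_cancel₀ two_pi_ne_zero, one_mul, weighted, weighted,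
    EuclideanSpace.inner_toLp_toLp, Matrix.star_vecMul, Matrix.dotProduct_mulVec,
    Matrix.vecMul_vecMul, ← Matrix.dotProduct_mulVec]

lemma quadForm_eq (F : Factorization f r w) (b : ℝ → Fin T → ℂ) :
    quadForm f b =ᵐ[freqMeasure] fun x => 2 * π * ‖weighted r b x‖ ^ 2 := by
  filter_upwards [F.inner_weighted] with x hx
  have h1 : (b x ⬝ᵥ (f x *ᵥ star (b x))) = ((2 * π * ‖weighted r b x‖ ^ 2 : ℝ) : ℂ) := by
    have := hx b b
    rw [inner_self_eq_norm_sq_to_K, eq_inv_mul_iff_mul_eq₀ two_pi_ne_zero] at this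
    rw [← this]; push_cast; rfl
  rw [quadForm, h1, Complex.ofReal_re]

lemma aestronglyMeasurable_weighted (F : Factorization f r w)
    (hb : AEStronglyMeasurable b freqMeasure) :
    AEStronglyMeasurable (weighted r b) freqMeasure := by
  have : AEStronglyMeasurable (fun x i => (b x ᵥ* r x) i) freqMeasure := by
    refine aestronglyMeasurable_vec fun i => ?_
    simp only [Matrix.vecMul, dotProduct]
    exact Finset.aestronglyMeasurable_fun_sum _ fun k _ =>
      (aestronglyMeasurable_coord hb k).mul (F.memLp k i).aestronglyMeasurable
  exact (PiLp.continuous_toLp 2 _).comp_aestronglyMeasurable this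

lemma memL2_iff (F : Factorization f r w) : MemL2 f b ↔
    AEStronglyMeasurable b freqMeasure ∧ MemLp (weighted r b) 2 freqMeasure := by
  constructor
  · rintro ⟨h1, h2⟩
    refine ⟨h1, (memLp_two_iff_integrable_sq_norm (F.aestronglyMeasurable_weighted h1)).2 ?_⟩
    refine ((h2.congr (F.quadForm_eq b)).const_mul (2 * π)⁻¹).congr
      (Eventually.of_forall fun x => ?_)
    simp only
    rw [← mul_assoc, inv_mul_cancel₀ Real.two_pi_pos.ne', one_mul]
  · rintro ⟨h1, h2⟩
    exact ⟨h1, (((memLp_two_iff_integrable_sq_norm h2.1).1 h2).const_mul (2 * π)).congr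
      (F.quadForm_eq b).symm⟩

lemma memLp_weighted (F : Factorization f r w) (hb : MemL2 f b) : MemLp (weighted r b) 2 freqMeasure :=
  (F.memL2_iff.1 hb).2

lemma memL2_add (F : Factorization f r w) (hb : MemL2 f b) (hc : MemL2 f c) :
    MemL2 f (b + c) :=
  F.memL2_iff.2 ⟨hb.1.add hc.1, by rw [weighted_add]; exact (F.memLp_weighted hb).add (F.memLp_weighted hc)⟩

lemma memL2_sub (F : Factorization f r w) (hb : MemL2 f b) (hc : MemL2 f c) :
    MemL2 f (b - c) :=
  F.memL2_iff.2 ⟨hb.1.sub hc.1, by rw [weighted_sub]; exact (F.memLp_weighted hb).sub (F.memLp_weighted hc)⟩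

lemma memL2_smul (F : Factorization f r w) (hb : MemL2 f b) (k : ℂ) : MemL2 f (k • b) :=
  F.memL2_iff.2 ⟨hb.1.const_smul k, by rw [weighted_smul]; exact (F.memLp_weighted hb).const_smul k⟩

lemma _root_.Interp.MemL2.congr_ae (hb : MemL2 f b) (h : b =ᵐ[freqMeasure] c) :
    MemL2 f c := by
  refine ⟨hb.1.congr h, hb.2.congr ?_⟩
  filter_upwards [h] with x hx
  simp [quadForm, hx]

end Factorization

lemma embed_of_memLp (h : MemLp (weighted r b) 2 freqMeasure) : embed r b = h.toLp := dif_pos h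

namespace Factorization

lemma coeFn_embed (F : Factorization f r w) (hb : MemL2 f b) :
    embed r b =ᵐ[freqMeasure] weighted r b := by
  rw [embed_of_memLp (F.memLp_weighted hb)]; exact MemLp.coeFn_toLp _

lemma embed_add (F : Factorization f r w) (hb : MemL2 f b) (hc : MemL2 f c) :
    embed r (b + c) = embed r b + embed r c := by
  rw [embed_of_memLp (F.memLp_weighted hb), embed_of_memLp (F.memLp_weighted hc),
    embed_of_memLp (F.memLp_weighted (F.memL2_add hb hc)), ← MemLp.toLp_add]
  congr 1; exact weighted_add

lemma embed_sub (F : Factorization f r w) (hb : MemL2 f b) (hc : MemL2 f c) :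
    embed r (b - c) = embed r b - embed r c := by
  rw [embed_of_memLp (F.memLp_weighted hb), embed_of_memLp (F.memLp_weighted hc),
    embed_of_memLp (F.memLp_weighted (F.memL2_sub hb hc)), ← MemLp.toLp_sub]
  congr 1; exact weighted_sub

lemma embed_smul (F : Factorization f r w) (hb : MemL2 f b) (k : ℂ) :
    embed r (k • b) = k • embed r b := by
  rw [embed_of_memLp (F.memLp_weighted hb), embed_of_memLp (F.memLp_weighted (F.memL2_smul hb k)),
    ← MemLp.toLp_const_smul]
  congr 1; exact weighted_smul k

lemma memL2_zero (F : Factorization f r w) : MemL2 f 0 :=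
  F.memL2_iff.2 ⟨aestronglyMeasurable_zero, by
    rw [show weighted r 0 = 0 by ext x i; simp [weighted]]; exact MemLp.zero⟩

lemma embed_zero (F : Factorization f r w) : embed r 0 = 0 := by
  simpa using F.embed_smul F.memL2_zero 0

lemma embed_sum (F : Factorization f r w) {ι : Type*} (s : Finset ι) {b : ι → ℝ → Fin T → ℂ}
    (hb : ∀ i ∈ s, MemL2 f (b i)) :
    MemL2 f (∑ i ∈ s, b i) ∧ embed r (∑ i ∈ s, b i) = ∑ i ∈ s, embed r (b i) := by
  classical
  induction s using Finset.induction_on with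
  | empty => simpa using ⟨F.memL2_zero, F.embed_zero⟩
  | insert i s hi ih =>
    obtain ⟨h1, h2⟩ := ih fun j hj => hb j (Finset.mem_insert_of_mem hj)
    have h3 := hb i (Finset.mem_insert_self i s)
    rw [Finset.sum_insert hi, Finset.sum_insert hi, F.embed_add h3 h1, h2]
    exact ⟨F.memL2_add h3 h1, rfl⟩

/-- Invertibility of `r` lets `b` be recovered from `rᵀ b`; this is the source of uniqueness up to
Lebesgue null sets. -/
lemma embed_eq_iff (F : Factorization f r w) (hb : MemL2 f b) (hc : MemL2 f c) :
    embed r b = embed r c ↔ b =ᵐ[freqMeasure] c := by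
  rw [embed_of_memLp (F.memLp_weighted hb), embed_of_memLp (F.memLp_weighted hc), MemLp.toLp_eq_toLp_iff]
  constructor
  · intro h
    filter_upwards [h, F.mul_inv] with x hx hw
    have h1 : b x ᵥ* r x = c x ᵥ* r x := congrArg (WithLp.ofLp) hx
    have h2 := congrArg (· ᵥ* w x) h1
    simpa [Matrix.vecMul_vecMul, hw] using h2
  · intro h
    filter_upwards [h] with x hx
    simp [weighted, hx]

lemma inner_embed (F : Factorization f r w) (hb : MemL2 f b) (hc : MemL2 f c) :
    inner ℂ (embed r b) (embed r c) =
      (2 * π : ℂ)⁻¹ * ∫ x, c x ⬝ᵥ (f x *ᵥ star (b x)) ∂freqMeasure := by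
  rw [L2.inner_def, ← integral_const_mul]
  refine integral_congr_ae ?_
  filter_upwards [F.coeFn_embed hb, F.coeFn_embed hc, F.inner_weighted] with x h1 h2 h3
  rw [h1, h2, h3]

lemma norm_embed_sq (F : Factorization f r w) (hb : MemL2 f b) :
    ‖embed r b‖ ^ 2 = (2 * π)⁻¹ * energy f b := by
  have h1 : ((‖embed r b‖ ^ 2 : ℝ) : ℂ) = inner ℂ (embed r b) (embed r b) := by
    rw [inner_self_eq_norm_sq_to_K]; push_cast; rfl
  have h2 : inner ℂ (embed r b) (embed r b) = ((∫ x, ‖weighted r b x‖ ^ 2 ∂freqMeasure : ℝ) : ℂ) := by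
    rw [L2.inner_def, ← integral_complex_ofReal]
    refine integral_congr_ae ?_
    filter_upwards [F.coeFn_embed hb] with x h1
    rw [h1, inner_self_eq_norm_sq_to_K]; push_cast; rfl
  rw [h2] at h1
  rw [Complex.ofReal_injective h1, energy, integral_congr_ae (F.quadForm_eq b),
    integral_const_mul, ← mul_assoc, inv_mul_cancel₀ Real.two_pi_pos.ne', one_mul]

lemma memL2_of_weighted_coord (F : Factorization f r w) (hb : AEStronglyMeasurable b freqMeasure)
    (h : ∀ i, MemLp (fun x => (b x ᵥ* r x) i) 2 freqMeasure) : MemL2 f b :=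
  F.memL2_iff.2 ⟨hb, memLp_piLp_iff.2 h⟩

lemma memL2_of_bound (F : Factorization f r w) (hb : AEStronglyMeasurable b freqMeasure) (C : ℝ)
    (h : ∀ x i, ‖b x i‖ ≤ C) : MemL2 f b := by
  refine F.memL2_of_weighted_coord hb fun i => ?_
  simp only [Matrix.vecMul, dotProduct]
  refine memLp_finsetSum _ fun k _ => ?_
  refine ((F.memLp k i).norm.const_mul C).mono
    ((aestronglyMeasurable_coord hb k).mul (F.memLp k i).1) (Eventually.of_forall fun x => ?_)
  rw [norm_mul, norm_mul, norm_norm]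
  gcongr
  exact (h x k).trans (le_abs_self C)

lemma aestronglyMeasurable_single {g : ℝ → ℂ} (hg : AEStronglyMeasurable g freqMeasure)
    (ν : Fin T) : AEStronglyMeasurable (fun x => (Pi.single ν (g x) : Fin T → ℂ)) freqMeasure :=
  (continuous_single ν).comp_aestronglyMeasurable hg

lemma memL2_single (F : Factorization f r w) {g : ℝ → ℂ} (hg : AEStronglyMeasurable g freqMeasure)
    (hb : ∀ x, ‖g x‖ ≤ 1) (ν : Fin T) : MemL2 f (fun x => (Pi.single ν (g x) : Fin T → ℂ)) := by
  refine F.memL2_of_bound (aestronglyMeasurable_single hg ν) 1 fun x i => ?_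
  by_cases hi : i = ν
  · subst hi; simpa using hb x
  · simp [Pi.single_eq_of_ne hi]

lemma continuous_exp (j : ℤ) : Continuous fun x : ℝ => Complex.exp (Complex.I * j * x) := by
  fun_prop

lemma memL2_expVec (F : Factorization f r w) (j : ℤ) (ν : Fin T) : MemL2 f (expVec j ν) :=
  F.memL2_single (continuous_exp j).aestronglyMeasurable (fun x => (norm_exp_I_int j x).le) ν

lemma memL2_indicator (F : Factorization f r w) {D : Set ℝ} (hD : MeasurableSet D) (ν : Fin T) :
    MemL2 f (fun x => (Pi.single ν (D.indicator (fun _ => (1 : ℂ)) x) : Fin T → ℂ)) :=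
  F.memL2_single (measurable_const.indicator hD).aestronglyMeasurable
    (fun x => (norm_indicator_le_norm_self _ _).trans (by simp)) ν

lemma memL2_simpleFunc (F : Factorization f r w) (φ : SimpleFunc ℝ (Fin T → ℂ)) : MemL2 f φ := by
  obtain ⟨C, hC⟩ := φ.exists_forall_norm_le
  exact F.memL2_of_bound φ.aestronglyMeasurable C fun x i => (norm_le_pi_norm _ i).trans (hC x)

/-- The components of `conj(r) u` are the densities of the functionals `⟪·, u⟫`. -/
lemma exists_density (F : Factorization f r w) (u : FreqSpace T) :
    ∃ G : Fin T → ℝ → ℂ, (∀ ν, Integrable (G ν) freqMeasure) ∧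
      (∀ ν (g : ℝ → ℂ), AEStronglyMeasurable g freqMeasure → (∀ x, ‖g x‖ ≤ 1) →
        inner ℂ (embed r fun x => (Pi.single ν (g x) : Fin T → ℂ)) u =
          ∫ x, conj (g x) * G ν x ∂freqMeasure) ∧
      ((∀ ν, ∀ᵐ x ∂freqMeasure, G ν x = 0) → u = 0) := by
  refine ⟨fun ν x => ∑ i, conj (r x ν i) * u x i, fun ν => ?_, fun ν g hg hg1 => ?_, fun h => ?_⟩
  · refine integrable_finsetSum _ fun i _ => ?_
    exact MemLp.integrable_mul (p := 2) (q := 2) (F.memLp ν i).star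
      ((Lp.memLp u).eval_piLp i)
  · rw [L2.inner_def]
    refine integral_congr_ae ?_
    filter_upwards [F.coeFn_embed (F.memL2_single hg hg1 ν)] with x hx
    rw [hx, weighted, PiLp.inner_apply, Finset.mul_sum]
    refine Finset.sum_congr rfl fun i _ => ?_
    simp [Matrix.single_vecMul]
    ring
  · rw [Lp.eq_zero_iff_ae_eq_zero]
    filter_upwards [F.mul_inv, ae_all_iff.2 h] with x hw hx
    have h1 : (u x).ofLp ᵥ* (r x)ᴴ = 0 := by
      ext ν
      rw [Pi.zero_apply, ← hx ν]
      simp [Matrix.vecMul, dotProduct, mul_comm]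
    have hw' : (r x)ᴴ * (w x)ᴴ = 1 := by
      have h2 := mul_eq_one_comm.1 hw
      rw [← Matrix.conjTranspose_mul, h2, Matrix.conjTranspose_one]
    have h2 := congrArg (· ᵥ* (w x)ᴴ) h1
    simp only [Matrix.vecMul_vecMul, hw', Matrix.vecMul_one, Matrix.zero_vecMul] at h2
    ext i
    simp [h2]

/-- Totality of all exponentials: the inner products are the Fourier coefficients of the integrable
densities of `u`. -/
lemma eq_zero_of_inner_expVec (F : Factorization f r w) {u : FreqSpace T}
    (h : ∀ j ν, inner ℂ (embed r (expVec j ν)) u = 0) : u = 0 := by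
  obtain ⟨G, hG, hin, hz⟩ := F.exists_density u
  refine hz fun ν => ae_eq_zero_of_fourier (hG ν) fun j => ?_
  -- The first argument of `inner` is conjugated, so frequency `-j` yields the coefficient with
  -- `e^{ijx}`.
  rw [← h (-j) ν]
  refine (Eq.trans ?_ (hin ν _ (continuous_exp (-j)).aestronglyMeasurable
    fun x => (norm_exp_I_int (-j) x).le).symm)
  refine integral_congr_ae (Eventually.of_forall fun x => ?_)
  simp [← Complex.exp_conj]

lemma eq_zero_of_inner_indicator (F : Factorization f r w) {u : FreqSpace T}
    (h : ∀ D, MeasurableSet D → ∀ ν, inner ℂ (embed r fun x =>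
      (Pi.single ν (D.indicator (fun _ => (1 : ℂ)) x) : Fin T → ℂ)) u = 0) : u = 0 := by
  obtain ⟨G, hG, hin, hz⟩ := F.exists_density u
  refine hz fun ν => ?_
  refine ae_eq_zero_of_forall_setIntegral_eq_of_sigmaFinite (fun D _ _ => (hG ν).integrableOn) ?_
  intro D hD _
  rw [← h D hD ν, hin ν _ (measurable_const.indicator hD).aestronglyMeasurable
    (fun x => (norm_indicator_le_norm_self _ _).trans (by simp)), ← integral_indicator hD]
  refine integral_congr_ae (Eventually.of_forall fun x => ?_)
  by_cases hx : x ∈ D <;> simp [hx]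

end Factorization

end

end

end Interp

namespace Interp

noncomputable section

/-! ### The positions of the missing observations -/

lemma blockStart_succ (N K : ℕ → ℕ) (l : ℕ) :
    blockStart N K (l + 1) = blockStart N K l + (N (l + 1) + K (l + 1)) := by
  rw [blockStart, Finset.sum_range_succ, ← blockStart]

lemma blockStart_mono (N K : ℕ → ℕ) : Monotone (blockStart N K) :=
  monotone_nat_of_le_succ fun l => by rw [blockStart_succ]; omega

/-- The blocks are disjoint, since `M_{l+1} ≥ M_l + N_{l+1}`. Thus distinct positions are distinct
times, as biorthogonality over positions requires. -/
lemma MissIdx.time_injective (s : ℕ) (N K : ℕ → ℕ) :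
    Function.Injective (MissIdx.time : MissIdx s N K → ℤ) := by
  have key : ∀ l m : ℕ, l < m → ∀ j, j ∈ block N K l → j ∉ block N K m := by
    intro l m hlm j hj hj'
    rw [block, Finset.mem_Icc] at hj hj'
    have := blockStart_mono N K (Nat.succ_le_of_lt hlm)
    rw [Nat.succ_eq_add_one, blockStart_succ] at this
    omega
  rintro ⟨⟨l, hl⟩, j, hj⟩ ⟨⟨m, hm⟩, j', hj'⟩ (rfl : j = j')
  have : l = m := by
    rcases lt_trichotomy l m with h | h | h
    · exact absurd hj' (key l m h j hj)
    · exact h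
    · exact absurd hj (key m l h j hj')
  subst this
  rfl

lemma mem_missingSet_iff {s : ℕ} {N K : ℕ → ℕ} {j : ℤ} :
    j ∈ missingSet s N K ↔ ∃ p : MissIdx s N K, p.time = j :=
  ⟨fun ⟨l, hl, hj⟩ => ⟨⟨⟨l, hl⟩, j, hj⟩, rfl⟩, fun ⟨p, hp⟩ => hp ▸ ⟨p.1, p.1.2, p.2.2⟩⟩

/-! ### The family dual to the exponentials -/

/-- The function `e^{ijx} (f(x)⁻¹)ᵀ δ_ν`. -/
def dualVec {T : ℕ} (f : ℝ → Matrix (Fin T) (Fin T) ℂ) (j : ℤ) (ν : Fin T) (x : ℝ) : Fin T → ℂ :=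
  expVec j ν x ᵥ* (f x)⁻¹

lemma exp_mul_conj_exp (j k : ℤ) (x : ℝ) :
    Complex.exp (Complex.I * j * x) * conj (Complex.exp (Complex.I * k * x)) =
      Complex.exp (Complex.I * ((j - k : ℤ) : ℂ) * x) := by
  rw [← Complex.exp_conj, ← Complex.exp_add]
  congr 1
  simp
  ring

section

variable {T : ℕ} {f r w : ℝ → Matrix (Fin T) (Fin T) ℂ}

namespace Factorization

lemma aestronglyMeasurable_inv (F : Factorization f r w) (ν i : Fin T) :
    AEStronglyMeasurable (fun x => (f x)⁻¹ ν i) freqMeasure := by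
  have : AEStronglyMeasurable (fun x => (2 * π : ℂ)⁻¹ * ∑ k, conj (w x k ν) * w x k i)
      freqMeasure :=
    (Finset.aestronglyMeasurable_fun_sum _ fun k _ =>
      (F.memLp_inv k ν).star.1.mul (F.memLp_inv k i).1).const_mul _
  refine this.congr ?_
  filter_upwards [F.inv_eq] with x hx
  simp [hx, Matrix.mul_apply]

lemma isHermitian_inv (F : Factorization f r w) : ∀ᵐ x ∂freqMeasure, ((f x)⁻¹)ᴴ = (f x)⁻¹ := by
  filter_upwards [F.inv_eq] with x hx
  rw [hx, Matrix.conjTranspose_smul, Matrix.conjTranspose_mul, Matrix.conjTranspose_conjTranspose]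
  congr 1
  simp

/-- Minimality enters here: `f⁻¹ r = (2π)⁻¹ wᴴ`, so the weighted function has entries of modulus `|w
i ν| / (2π)`, which are square integrable. -/
lemma memL2_dualVec (F : Factorization f r w) (j : ℤ) (ν : Fin T) : MemL2 f (dualVec f j ν) := by
  refine F.memL2_of_weighted_coord (aestronglyMeasurable_vec fun i => ?_) fun i => ?_
  · refine ((continuous_exp j).aestronglyMeasurable.mul
      (F.aestronglyMeasurable_inv ν i)).congr (Eventually.of_forall fun x => ?_)
    simp [dualVec, expVec, Matrix.single_vecMul]
  · have h1 : MemLp (fun x : ℝ => (2 * π : ℂ)⁻¹ * (Complex.exp (Complex.I * j * x) * conj (w x i ν)))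
        2 freqMeasure := by
      refine MemLp.const_mul ?_ _
      refine (F.memLp_inv i ν).mono
        ((continuous_exp j).aestronglyMeasurable.mul (F.memLp_inv i ν).star.1)
        (Eventually.of_forall fun x => ?_)
      rw [norm_mul, norm_exp_I_int, one_mul, RCLike.norm_conj]
    refine (memLp_congr_ae ?_).1 h1
    filter_upwards [F.inv_eq, F.mul_inv] with x hx hw
    have h2 : (f x)⁻¹ * r x = (2 * π : ℂ)⁻¹ • (w x)ᴴ := by
      rw [hx, Matrix.smul_mul, Matrix.mul_assoc, mul_eq_one_comm.1 hw, Matrix.mul_one]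
    rw [dualVec, Matrix.vecMul_vecMul, h2]
    simp [expVec, Matrix.single_vecMul]
    ring

/-- The factor `f⁻¹` cancels the weight `f`, leaving the conjugate of a Fourier coefficient of `b`.
-/
lemma inner_embed_dualVec (F : Factorization f r w) {b : ℝ → Fin T → ℂ} (hb : MemL2 f b) (j : ℤ)
    (ν : Fin T) : inner ℂ (embed r b) (embed r (dualVec f j ν)) =
      (2 * π : ℂ)⁻¹ * ∫ x, Complex.exp (Complex.I * j * x) * conj (b x ν) ∂freqMeasure := by
  rw [F.inner_embed hb (F.memL2_dualVec j ν)]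
  congr 1
  refine integral_congr_ae ?_
  filter_upwards [F.isUnit_det] with x hx
  rw [dualVec, Matrix.dotProduct_mulVec, Matrix.vecMul_vecMul, Matrix.nonsing_inv_mul _ hx,
    Matrix.vecMul_one, expVec, single_dotProduct]
  rfl

lemma inner_expVec_dualVec (F : Factorization f r w) (j k : ℤ) (μ ν : Fin T) :
    inner ℂ (embed r (expVec j μ)) (embed r (dualVec f k ν)) =
      if j = k ∧ μ = ν then 1 else 0 := by
  rw [F.inner_embed_dualVec (F.memL2_expVec j μ)]
  by_cases h : μ = ν
  · subst h
    simp only [expVec, Pi.single_eq_same, exp_mul_conj_exp, integral_exp_freqMeasure, sub_eq_zero,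
      and_true, eq_comm (a := k)]
    split_ifs
    · exact inv_mul_cancel₀ two_pi_ne_zero
    · simp
  · simp [expVec, h]

/-- The transpose in `B(k, j)` appears because the conjugated factor is an entry of the Hermitian
matrix `f⁻¹`. -/
lemma inner_dualVec_dualVec (F : Factorization f r w) {s : ℕ} {N K : ℕ → ℕ}
    (p q : MissIdx s N K × Fin T) :
    inner ℂ (embed r (dualVec f p.1.time p.2)) (embed r (dualVec f q.1.time q.2)) =
      BMat s N K f p q := by
  rw [F.inner_embed_dualVec (F.memL2_dualVec _ _), BMat, Matrix.of_apply]
  congr 1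
  refine integral_congr_ae ?_
  filter_upwards [F.isHermitian_inv] with x hx
  have h1 : conj ((f x)⁻¹ p.2 q.2) = (f x)⁻¹ q.2 p.2 := by
    conv_rhs => rw [← hx]
    rfl
  rw [dualVec, expVec, Matrix.single_vecMul]
  simp only [Pi.smul_apply, Matrix.row_apply, smul_eq_mul, map_mul, Matrix.transpose_apply, h1]
  rw [← mul_assoc, exp_mul_conj_exp, mul_comm]

end Factorization

lemma trigPoly_eq_sum {s : ℕ} {N K : ℕ → ℕ} (v : MissIdx s N K × Fin T → ℂ) :
    trigPoly v = ∑ q, v q • expVec q.1.time q.2 := by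
  ext x ν
  simp only [trigPoly, Finset.sum_apply, Pi.smul_apply, smul_eq_mul, expVec]
  rw [Fintype.sum_prod_type]
  refine Finset.sum_congr rfl fun p _ => ?_
  rw [Finset.sum_eq_single ν]
  · simp
  · intro μ _ hμ; simp [Pi.single_eq_of_ne hμ.symm]
  · simp

lemma trigPoly_vecMul_eq_sum {s : ℕ} {N K : ℕ → ℕ} (v : MissIdx s N K × Fin T → ℂ) :
    (fun x => trigPoly v x ᵥ* (f x)⁻¹) = ∑ q, v q • dualVec f q.1.time q.2 := by
  funext x
  simp only [trigPoly_eq_sum, Finset.sum_apply, Pi.smul_apply, dualVec, Matrix.sum_vecMul,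
    Matrix.smul_vecMul]

namespace Factorization

lemma embed_trigPoly (F : Factorization f r w) {s : ℕ} {N K : ℕ → ℕ}
    (v : MissIdx s N K × Fin T → ℂ) : MemL2 f (trigPoly v) ∧
      embed r (trigPoly v) = ∑ q, v q • embed r (expVec q.1.time q.2) := by
  have := F.embed_sum Finset.univ (b := fun q => v q • expVec q.1.time q.2)
    fun q _ => F.memL2_smul (F.memL2_expVec _ _) _
  rw [trigPoly_eq_sum]
  simpa only [F.embed_smul (F.memL2_expVec _ _)] using this

lemma embed_trigPoly_vecMul (F : Factorization f r w) {s : ℕ} {N K : ℕ → ℕ}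
    (v : MissIdx s N K × Fin T → ℂ) : MemL2 f (fun x => trigPoly v x ᵥ* (f x)⁻¹) ∧
      embed r (fun x => trigPoly v x ᵥ* (f x)⁻¹) =
        ∑ q, v q • embed r (dualVec f q.1.time q.2) := by
  have := F.embed_sum Finset.univ (b := fun q => v q • dualVec f q.1.time q.2)
    fun q _ => F.memL2_smul (F.memL2_dualVec _ _) _
  rw [trigPoly_vecMul_eq_sum]
  simpa only [F.embed_smul (F.memL2_dualVec _ _)] using this

lemma inner_expVec_sum_dualVec (F : Factorization f r w) {s : ℕ} {N K : ℕ → ℕ}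
    (v : MissIdx s N K × Fin T → ℂ) (p : MissIdx s N K × Fin T) :
    inner ℂ (embed r (expVec p.1.time p.2)) (∑ q, v q • embed r (dualVec f q.1.time q.2)) =
      v p := by
  rw [inner_sum, Finset.sum_eq_single p]
  · rw [inner_smul_right, F.inner_expVec_dualVec]; simp
  · intro q _ hq
    rw [inner_smul_right, F.inner_expVec_dualVec, if_neg, mul_zero]
    rintro ⟨h1, h2⟩
    exact hq (Prod.ext (MissIdx.time_injective s N K h1.symm) h2.symm)
  · simp

lemma inner_expVec_sum_dualVec_of_notMem (F : Factorization f r w) {s : ℕ} {N K : ℕ → ℕ}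
    (v : MissIdx s N K × Fin T → ℂ) {j : ℤ} (hj : j ∉ missingSet s N K) (ν : Fin T) :
    inner ℂ (embed r (expVec j ν)) (∑ q, v q • embed r (dualVec f q.1.time q.2)) = 0 := by
  rw [inner_sum]
  refine Finset.sum_eq_zero fun q _ => ?_
  rw [inner_smul_right, F.inner_expVec_dualVec, if_neg, mul_zero]
  rintro ⟨h1, _⟩
  exact hj (mem_missingSet_iff.2 ⟨q.1, h1.symm⟩)

lemma inner_dualVec_sum_dualVec (F : Factorization f r w) {s : ℕ} {N K : ℕ → ℕ}
    (v : MissIdx s N K × Fin T → ℂ) (p : MissIdx s N K × Fin T) :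
    inner ℂ (embed r (dualVec f p.1.time p.2)) (∑ q, v q • embed r (dualVec f q.1.time q.2)) =
      (BMat s N K f *ᵥ v) p := by
  simp only [inner_sum, inner_smul_right, F.inner_dualVec_dualVec, Matrix.mulVec, dotProduct,
    mul_comm]

lemma inner_sum_dualVec_sum_dualVec (F : Factorization f r w) {s : ℕ} {N K : ℕ → ℕ}
    (u v : MissIdx s N K × Fin T → ℂ) :
    inner ℂ (∑ q, u q • embed r (dualVec f q.1.time q.2))
      (∑ q, v q • embed r (dualVec f q.1.time q.2)) = star u ⬝ᵥ (BMat s N K f *ᵥ v) := by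
  rw [sum_inner]
  simp only [inner_smul_left, F.inner_dualVec_sum_dualVec, dotProduct]
  rfl

/-- A Gram matrix is injective when its family is independent: `B v = 0` forces `∑ v_q dual_q = 0`,
and pairing with the exponentials reads off each `v_p = 0`. -/
lemma isUnit_det_BMat (F : Factorization f r w) (s : ℕ) (N K : ℕ → ℕ) :
    IsUnit (BMat s N K f).det := by
  rw [← Matrix.isUnit_iff_isUnit_det, ← Matrix.mulVec_injective_iff_isUnit]
  refine (injective_iff_map_eq_zero (BMat s N K f).mulVecLin).2 fun v hv => ?_
  rw [Matrix.mulVecLin_apply] at hv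
  have h0 : ∑ q, v q • embed r (dualVec f q.1.time q.2) = 0 := by
    rw [← inner_self_eq_zero (𝕜 := ℂ), F.inner_sum_dualVec_sum_dualVec, hv, dotProduct_zero]
  ext p
  rw [← F.inner_expVec_sum_dualVec v p, h0, inner_zero_right]
  rfl

lemma BMat_mulVec_cVec (F : Factorization f r w) (s : ℕ) (N K : ℕ → ℕ) (a : ℤ → Fin T → ℂ) :
    BMat s N K f *ᵥ cVec s N K f a = aVec s N K a := by
  rw [cVec, Matrix.mulVec_mulVec, Matrix.mul_nonsing_inv _ (F.isUnit_det_BMat s N K),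
    Matrix.one_mulVec]

end Factorization

/-! ### The closed span of the observed exponentials -/

/-- The image of `L₂^{s-}(f)` in the Lebesgue space. -/
def observedFreq (r : ℝ → Matrix (Fin T) (Fin T) ℂ) (S : Set ℤ) : Submodule ℂ (FreqSpace T) :=
  (Submodule.span ℂ {u | ∃ j, j ∉ S ∧ ∃ ν, u = embed r (expVec j ν)}).topologicalClosure

lemma mem_orthogonal_observedFreq_iff {S : Set ℤ} {u : FreqSpace T} :
    u ∈ (observedFreq r S)ᗮ ↔ ∀ j, j ∉ S → ∀ ν, inner ℂ (embed r (expVec j ν)) u = 0 := by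
  rw [observedFreq, Submodule.orthogonal_closure]
  constructor
  · intro h j hj ν
    exact (Submodule.mem_orthogonal _ _).1 h _ (Submodule.subset_span ⟨j, hj, ν, rfl⟩)
  · intro h
    rw [Submodule.mem_orthogonal]
    intro y hy
    induction hy using Submodule.span_induction with
    | mem y hy => obtain ⟨j, hj, ν, rfl⟩ := hy; exact h j hj ν
    | zero => simp
    | add y z _ _ h1 h2 => rw [inner_add_left, h1, h2, add_zero]
    | smul k y _ h1 => rw [inner_smul_left, h1, mul_zero]

namespace Factorization

lemma embed_mem_span_iff (F : Factorization f r w) (S : Set ℤ) {u : FreqSpace T} :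
    u ∈ Submodule.span ℂ {u | ∃ j, j ∉ S ∧ ∃ ν, u = embed r (expVec j ν)} ↔
      ∃ p ∈ Submodule.span ℂ {b : ℝ → Fin T → ℂ | ∃ j, j ∉ S ∧ ∃ ν, b = expVec j ν},
        MemL2 f p ∧ embed r p = u := by
  constructor
  · intro h
    induction h using Submodule.span_induction with
    | mem u hu =>
      obtain ⟨j, hj, ν, rfl⟩ := hu
      exact ⟨_, Submodule.subset_span ⟨j, hj, ν, rfl⟩, F.memL2_expVec j ν, rfl⟩
    | zero => exact ⟨0, Submodule.zero_mem _, F.memL2_zero, F.embed_zero⟩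
    | add u v _ _ h1 h2 =>
      obtain ⟨p, hp, hp2, rfl⟩ := h1
      obtain ⟨q, hq, hq2, rfl⟩ := h2
      exact ⟨p + q, Submodule.add_mem _ hp hq, F.memL2_add hp2 hq2, F.embed_add hp2 hq2⟩
    | smul k u _ h1 =>
      obtain ⟨p, hp, hp2, rfl⟩ := h1
      exact ⟨k • p, Submodule.smul_mem _ k hp, F.memL2_smul hp2 k, F.embed_smul hp2 k⟩
  · rintro ⟨p, hp, -, rfl⟩
    suffices MemL2 f p ∧ embed r p ∈
        Submodule.span ℂ {u | ∃ j, j ∉ S ∧ ∃ ν, u = embed r (expVec j ν)} from this.2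
    induction hp using Submodule.span_induction with
    | mem u hu =>
      obtain ⟨j, hj, ν, rfl⟩ := hu
      exact ⟨F.memL2_expVec j ν, Submodule.subset_span ⟨j, hj, ν, rfl⟩⟩
    | zero => exact ⟨F.memL2_zero, F.embed_zero ▸ Submodule.zero_mem _⟩
    | add u v _ _ h1 h2 =>
      exact ⟨F.memL2_add h1.1 h2.1, F.embed_add h1.1 h2.1 ▸ Submodule.add_mem _ h1.2 h2.2⟩
    | smul k u _ h1 =>
      exact ⟨F.memL2_smul h1.1 k, F.embed_smul h1.1 k ▸ Submodule.smul_mem _ k h1.2⟩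

lemma memL2_of_mem_span (F : Factorization f r w) {S : Set ℤ} {p : ℝ → Fin T → ℂ}
    (hp : p ∈ Submodule.span ℂ {b : ℝ → Fin T → ℂ | ∃ j, j ∉ S ∧ ∃ ν, b = expVec j ν}) :
    MemL2 f p := by
  induction hp using Submodule.span_induction with
  | mem u hu => obtain ⟨j, hj, ν, rfl⟩ := hu; exact F.memL2_expVec j ν
  | zero => exact F.memL2_zero
  | add u v _ _ h1 h2 => exact F.memL2_add h1 h2
  | smul k u _ h1 => exact F.memL2_smul h1 k

/-- Translates the closure by energy of functions into a Hilbert space closure of classes; squared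
distance is energy over `2π`, whence the choices of tolerance. -/
lemma mem_L2minus_iff (F : Factorization f r w) {S : Set ℤ} {g : ℝ → Fin T → ℂ} :
    g ∈ L2minus f S ↔ MemL2 f g ∧ embed r g ∈ observedFreq r S := by
  refine and_congr_right fun hg => ?_
  have h2π := Real.two_pi_pos
  have hdist {p} (hp : MemL2 f p) :
      dist (embed r g) (embed r p) ^ 2 = (2 * π)⁻¹ * energy f (g - p) := by
    rw [dist_eq_norm, ← F.embed_sub hg hp, F.norm_embed_sq (F.memL2_sub hg hp)]
  rw [observedFreq, ← SetLike.mem_coe, Submodule.topologicalClosure_coe, Metric.mem_closure_iff]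
  constructor
  · intro h ε hε
    obtain ⟨p, hp, hlt⟩ := h (2 * π * ε ^ 2) (by positivity)
    have hp2 := F.memL2_of_mem_span hp
    refine ⟨embed r p, (F.embed_mem_span_iff S).2 ⟨p, hp, hp2, rfl⟩, ?_⟩
    refine lt_of_pow_lt_pow_left₀ 2 hε.le ?_
    rw [hdist hp2, inv_mul_lt_iff₀ h2π]
    exact hlt
  · intro h ε hε
    obtain ⟨u, hu, hlt⟩ := h (Real.sqrt ((2 * π)⁻¹ * ε)) (by positivity)
    obtain ⟨p, hp, hp2, rfl⟩ := (F.embed_mem_span_iff S).1 hu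
    refine ⟨p, hp, ?_⟩
    have := pow_lt_pow_left₀ hlt dist_nonneg two_ne_zero
    rw [hdist hp2, Real.sq_sqrt (by positivity)] at this
    exact lt_of_mul_lt_mul_left this (by positivity)

/-! ### The spectral characteristic as an orthogonal projection -/

lemma memL2_specChar (F : Factorization f r w) (s : ℕ) (N K : ℕ → ℕ) (a : ℤ → Fin T → ℂ) :
    MemL2 f (specChar s N K f a) ∧ embed r (specChar s N K f a) =
      embed r (trigPoly (aVec s N K a)) -
        ∑ q, cVec s N K f a q • embed r (dualVec f q.1.time q.2) := by
  obtain ⟨h1, -⟩ := F.embed_trigPoly (aVec s N K a)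
  obtain ⟨h3, h4⟩ := F.embed_trigPoly_vecMul (cVec s N K f a)
  have : specChar s N K f a =
      trigPoly (aVec s N K a) - fun x => trigPoly (cVec s N K f a) x ᵥ* (f x)⁻¹ := rfl
  rw [this, F.embed_sub h1 h3, h4]
  exact ⟨F.memL2_sub h1 h3, rfl⟩

lemma sub_specChar_mem_orthogonal (F : Factorization f r w) (s : ℕ) (N K : ℕ → ℕ)
    (a : ℤ → Fin T → ℂ) :
    embed r (trigPoly (aVec s N K a)) - embed r (specChar s N K f a) ∈
      (observedFreq r (missingSet s N K))ᗮ := by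
  rw [(F.memL2_specChar s N K a).2, sub_sub_cancel, mem_orthogonal_observedFreq_iff]
  exact fun j hj ν => F.inner_expVec_sum_dualVec_of_notMem _ hj ν

/-- With coefficients `⟪exp_q, u⟫`, the difference of the two sides is orthogonal to every
exponential: by biorthogonality at missing times, and because both terms vanish at observed ones.
Totality finishes. -/
lemma eq_sum_dualVec_of_mem_orthogonal (F : Factorization f r w) {s : ℕ} {N K : ℕ → ℕ}
    {u : FreqSpace T} (hu : u ∈ (observedFreq r (missingSet s N K))ᗮ) :
    ∃ d : MissIdx s N K × Fin T → ℂ, u = ∑ q, d q • embed r (dualVec f q.1.time q.2) := by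
  rw [mem_orthogonal_observedFreq_iff] at hu
  refine ⟨fun q => inner ℂ (embed r (expVec q.1.time q.2)) u, ?_⟩
  rw [← sub_eq_zero]
  refine F.eq_zero_of_inner_expVec fun j ν => ?_
  rw [inner_sub_right]
  by_cases hj : j ∈ missingSet s N K
  · obtain ⟨p, rfl⟩ := mem_missingSet_iff.1 hj
    rw [F.inner_expVec_sum_dualVec _ (p, ν), sub_self]
  · rw [hu j hj ν, F.inner_expVec_sum_dualVec_of_notMem _ hj, sub_zero]

/-- A closed subspace is its own double complement, so orthogonality to the dual functions suffices.
That is the equation `B_s c = a_s`. -/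
lemma embed_specChar_mem (F : Factorization f r w) (s : ℕ) (N K : ℕ → ℕ) (a : ℤ → Fin T → ℂ) :
    embed r (specChar s N K f a) ∈ observedFreq r (missingSet s N K) := by
  have hM : (observedFreq r (missingSet s N K))ᗮᗮ = observedFreq r (missingSet s N K) := by
    rw [Submodule.orthogonal_orthogonal_eq_closure]
    exact (Submodule.isClosed_topologicalClosure _).submodule_topologicalClosure_eq
  rw [← hM, Submodule.mem_orthogonal]
  intro u hu
  obtain ⟨d, rfl⟩ := F.eq_sum_dualVec_of_mem_orthogonal hu
  rw [(F.memL2_specChar s N K a).2, inner_sub_right, F.inner_sum_dualVec_sum_dualVec,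
    F.BMat_mulVec_cVec, (F.embed_trigPoly _).2, inner_sum, sub_eq_zero, dotProduct]
  refine Finset.sum_congr rfl fun q _ => ?_
  rw [inner_smul_right, ← inner_conj_symm, F.inner_expVec_sum_dualVec, mul_comm]
  rfl

lemma specChar_mem_L2minus (F : Factorization f r w) (s : ℕ) (N K : ℕ → ℕ)
    (a : ℤ → Fin T → ℂ) : specChar s N K f a ∈ L2minus f (missingSet s N K) :=
  F.mem_L2minus_iff.2 ⟨(F.memL2_specChar s N K a).1, F.embed_specChar_mem s N K a⟩

lemma meanSquareError_eq (F : Factorization f r w) {A g : ℝ → Fin T → ℂ} (hA : MemL2 f A)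
    (hg : MemL2 f g) : meanSquareError f A g = ‖embed r A - embed r g‖ ^ 2 := by
  rw [meanSquareError, ← F.norm_embed_sq (F.memL2_sub hA hg), F.embed_sub hA hg]

/-- The Gram form gives `c* B_s c = c* a_s`; being a real number, it equals its conjugate `⟨c, a⟩`.
-/
lemma norm_sub_specChar_sq (F : Factorization f r w) (s : ℕ) (N K : ℕ → ℕ) (a : ℤ → Fin T → ℂ) :
    ((‖embed r (trigPoly (aVec s N K a)) - embed r (specChar s N K f a)‖ ^ 2 : ℝ) : ℂ) =
      cVec s N K f a ⬝ᵥ star (aVec s N K a) := by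
  have h := F.inner_sum_dualVec_sum_dualVec (cVec s N K f a) (cVec s N K f a)
  rw [inner_self_eq_norm_sq_to_K, F.BMat_mulVec_cVec] at h
  rw [(F.memL2_specChar s N K a).2, sub_sub_cancel, dotProduct_comm, ← star_star (star _ ⬝ᵥ _),
    ← Matrix.star_dotProduct, ← h]
  simp

end Factorization

/-- Pythagoras: the distance to a subspace through the orthogonal projection. -/
lemma norm_sub_sq_of_mem_orthogonal {H : Type*} [NormedAddCommGroup H] [InnerProductSpace ℂ H]
    {M : Submodule ℂ H} {x y z : H} (hy : y ∈ M) (hxy : x - y ∈ Mᗮ) (hz : z ∈ M) :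
    ‖x - z‖ ^ 2 = ‖x - y‖ ^ 2 + ‖y - z‖ ^ 2 := by
  have h := (Submodule.mem_orthogonal' M (x - y)).1 hxy (y - z) (M.sub_mem hy hz)
  have := norm_add_sq_eq_norm_sq_add_norm_sq_of_inner_eq_zero (x - y) (y - z) h
  rw [sub_add_sub_cancel] at this
  nlinarith

end

end

end Interp

namespace Interp

noncomputable section

/-! ### An isometry between families with the same Gram matrix -/

lemma topologicalClosure_span_eq_top {H : Type*} [NormedAddCommGroup H] [InnerProductSpace ℂ H]
    [CompleteSpace H] {s : Set H} (hs : ∀ u : H, (∀ y ∈ s, inner ℂ y u = 0) → u = 0) :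
    (Submodule.span ℂ s).topologicalClosure = ⊤ := by
  rw [Submodule.topologicalClosure_eq_top_iff, Submodule.eq_bot_iff]
  exact fun u hu => hs u fun y hy => (Submodule.mem_orthogonal _ _).1 hu y (Submodule.subset_span hy)

/-- Equal Gram matrices give equal norms to corresponding formal combinations, so `e i ↦ y i` is
well defined and isometric on the span of `e`, which is dense by `htotal`. -/
lemma exists_linearIsometry {ι H L : Type*} [NormedAddCommGroup H] [InnerProductSpace ℂ H]
    [CompleteSpace H] [NormedAddCommGroup L] [InnerProductSpace ℂ L] [CompleteSpace L]
    (e : ι → H) (y : ι → L) (hgram : ∀ i j, inner ℂ (y i) (y j) = inner ℂ (e i) (e j))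
    (htotal : ∀ u : H, (∀ i, inner ℂ (e i) u = 0) → u = 0) :
    ∃ Φ : H →ₗᵢ[ℂ] L, ∀ i, Φ (e i) = y i := by
  let A := Finsupp.linearCombination ℂ e
  let B := Finsupp.linearCombination ℂ y
  have hinner (v : ι →₀ ℂ) : inner ℂ (B v) (B v) = inner ℂ (A v) (A v) := by
    simp only [A, B, Finsupp.linearCombination_apply, Finsupp.sum, sum_inner, inner_sum,
      inner_smul_left, inner_smul_right, hgram]
  have hnorm (v : ι →₀ ℂ) : ‖B v‖ = ‖A v‖ := by
    rw [@norm_eq_sqrt_re_inner ℂ, hinner, ← @norm_eq_sqrt_re_inner ℂ]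
  have hdense : DenseRange A := by
    have h := topologicalClosure_span_eq_top (s := range e) fun u hu =>
      htotal u fun i => hu _ (mem_range_self i)
    rw [← Submodule.dense_iff_topologicalClosure_eq_top, ← Finsupp.range_linearCombination] at h
    exact h
  have hbound : ∃ C, ∀ v, ‖B v‖ ≤ C * ‖A v‖ := ⟨1, fun v => by rw [one_mul, hnorm]⟩
  let Ψ := B.extendOfNorm A
  have hΨ (v : ι →₀ ℂ) : Ψ (A v) = B v := LinearMap.extendOfNorm_eq hdense hbound v
  have hiso (u : H) : ‖Ψ u‖ = ‖u‖ := by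
    refine hdense.induction_on u (isClosed_eq (by fun_prop) (by fun_prop)) fun v => ?_
    rw [hΨ, hnorm]
  refine ⟨⟨Ψ.toLinearMap, hiso⟩, fun i => ?_⟩
  have := hΨ (Finsupp.single i 1)
  simpa [A, B] using this

/-! ### The spectral isometry, random measures and stochastic integrals -/

section Probability

variable {Ω : Type*} [MeasurableSpace Ω] {P : Measure Ω} {T : ℕ}
  {f r w : ℝ → Matrix (Fin T) (Fin T) ℂ} {ξ : ℤ → Fin T → Ω → ℂ}

lemma inner_Lp (X Y : Lp ℂ 2 P) : inner ℂ X Y = ∫ ω, Y ω * conj (X ω) ∂P := by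
  rw [L2.inner_def]; rfl

lemma norm_sub_sq_eq_integral (X Y : Lp ℂ 2 P) {X' : Ω → ℂ} (hX : X =ᵐ[P] X') :
    ∫ ω, ‖X' ω - Y ω‖ ^ 2 ∂P = ‖X - Y‖ ^ 2 := by
  have h1 : ((‖X - Y‖ ^ 2 : ℝ) : ℂ) = inner ℂ (X - Y) (X - Y) := by
    rw [inner_self_eq_norm_sq_to_K]; push_cast; rfl
  apply Complex.ofReal_injective
  rw [h1, L2.inner_def, ← integral_complex_ofReal]
  refine integral_congr_ae ?_
  filter_upwards [hX, Lp.coeFn_sub X Y] with ω h2 h3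
  rw [h3, Pi.sub_apply, h2, inner_self_eq_norm_sq_to_K]; push_cast; rfl

/-- The class of `δ_ν` times the indicator of `D`. -/
def embedInd (r : ℝ → Matrix (Fin T) (Fin T) ℂ) (D : Set ℝ) (ν : Fin T) : FreqSpace T :=
  embed r fun x => Pi.single ν (D.indicator (fun _ => (1 : ℂ)) x)

namespace Factorization

lemma inner_expVec_expVec (F : Factorization f r w) (m n : ℤ) (μ ν : Fin T) :
    inner ℂ (embed r (expVec m μ)) (embed r (expVec n ν)) = (2 * π : ℂ)⁻¹ *
      ∫ x, Complex.exp (Complex.I * ((n - m : ℤ) : ℂ) * x) * f x ν μ ∂freqMeasure := by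
  rw [F.inner_embed (F.memL2_expVec m μ) (F.memL2_expVec n ν)]
  congr 1
  refine integral_congr_ae (Eventually.of_forall fun x => ?_)
  simp only [expVec, ← Pi.single_star, single_dotProduct, Matrix.mulVec_single]
  rw [← exp_mul_conj_exp]
  simp [mul_comm, mul_left_comm]

lemma inner_embedInd_embedInd (F : Factorization f r w) {D D' : Set ℝ} (hD : MeasurableSet D)
    (hD' : MeasurableSet D') (hs : D ⊆ Ioc (-π) π) (μ ν : Fin T) :
    inner ℂ (embedInd r D' μ) (embedInd r D ν) = (2 * π : ℂ)⁻¹ * ∫ x in D ∩ D', f x ν μ := by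
  rw [embedInd, embedInd, F.inner_embed (F.memL2_indicator hD' μ) (F.memL2_indicator hD ν)]
  congr 1
  have h1 : ∫ x in D ∩ D', f x ν μ = ∫ x in D ∩ D', f x ν μ ∂freqMeasure := by
    rw [freqMeasure, Measure.restrict_restrict (hD.inter hD'),
      inter_eq_self_of_subset_left (inter_subset_left.trans hs)]
  rw [h1, ← integral_indicator (hD.inter hD')]
  refine integral_congr_ae (Eventually.of_forall fun x => ?_)
  simp only [← Pi.single_star, single_dotProduct, Matrix.mulVec_single]
  by_cases h1 : x ∈ D <;> by_cases h2 : x ∈ D' <;> simp [h1, h2]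

lemma embed_simpleFunc (F : Factorization f r w) (φ : SimpleFunc ℝ (Fin T → ℂ)) :
    embed r φ = ∑ b ∈ φ.range, ∑ ν, b ν • embedInd r (φ ⁻¹' {b} ∩ Ioc (-π) π) ν := by
  have hm (b : Fin T → ℂ) : MeasurableSet (φ ⁻¹' {b} ∩ Ioc (-π) π) :=
    (φ.measurableSet_fiber b).inter measurableSet_Ioc
  have h1 (b : Fin T → ℂ) (ν : Fin T) := F.memL2_indicator (hm b) ν
  have h2 (b : Fin T → ℂ) := F.embed_sum Finset.univ fun ν _ => F.memL2_smul (h1 b ν) (b ν)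
  have h3 := F.embed_sum φ.range fun b _ => (h2 b).1
  simp only [embedInd, ← F.embed_smul (h1 _ _), ← (h2 _).2, ← h3.2]
  rw [F.embed_eq_iff (F.memL2_simpleFunc φ) h3.1]
  -- Cutting the level sets down to `(-π, π]` changes the function only on a null set of
  -- `freqMeasure`.
  filter_upwards [ae_restrict_mem measurableSet_Ioc] with x hx
  ext i
  simp only [Finset.sum_apply, Pi.smul_apply, smul_eq_mul]
  rw [Finset.sum_eq_single (φ x), Finset.sum_eq_single i]
  · have : x ∈ φ ⁻¹' {φ x} ∩ Ioc (-π) π := ⟨rfl, hx⟩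
    simp [indicator_of_mem this]
  · intro ν _ hν; simp [Pi.single_eq_of_ne hν.symm]
  · simp
  · intro b _ hb
    have : x ∉ φ ⁻¹' {b} ∩ Ioc (-π) π := fun h => hb h.1.symm
    simp [indicator_of_notMem this]
  · intro h; exact absurd (φ.mem_range_self x) h

/-- Indicators times unit vectors are total, and each element of their span is the class of a simple
function. -/
lemma exists_tendsto_simpleFunc (F : Factorization f r w) (u : FreqSpace T) :
    ∃ φ : ℕ → SimpleFunc ℝ (Fin T → ℂ), Tendsto (fun n => embed r (φ n)) atTop (𝓝 u) := by
  let s : Set (FreqSpace T) := {y | ∃ D, MeasurableSet D ∧ ∃ ν, y = embedInd r D ν}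
  have h1 : (Submodule.span ℂ s).topologicalClosure = ⊤ :=
    topologicalClosure_span_eq_top fun u hu => F.eq_zero_of_inner_indicator fun D hD ν =>
      hu _ ⟨D, hD, ν, rfl⟩
  have h2 : ∀ y ∈ Submodule.span ℂ s, ∃ φ : SimpleFunc ℝ (Fin T → ℂ), embed r φ = y := by
    intro y hy
    induction hy using Submodule.span_induction with
    | mem y hy =>
      obtain ⟨D, hD, ν, rfl⟩ := hy
      refine ⟨SimpleFunc.piecewise D hD (SimpleFunc.const ℝ (Pi.single ν 1))
        (SimpleFunc.const ℝ 0), ?_⟩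
      rw [embedInd]
      congr 1
      funext x
      by_cases hx : x ∈ D <;> simp [hx]
    | zero => exact ⟨0, F.embed_zero⟩
    | add y z _ _ hy hz =>
      obtain ⟨φ, rfl⟩ := hy
      obtain ⟨ψ, rfl⟩ := hz
      exact ⟨φ + ψ, F.embed_add (F.memL2_simpleFunc φ) (F.memL2_simpleFunc ψ)⟩
    | smul k y _ hy =>
      obtain ⟨φ, rfl⟩ := hy
      exact ⟨k • φ, F.embed_smul (F.memL2_simpleFunc φ) k⟩
  have h3 : u ∈ closure (Submodule.span ℂ s : Set (FreqSpace T)) := by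
    rw [← Submodule.topologicalClosure_coe, h1]; exact mem_univ u
  obtain ⟨v, hv, hlim⟩ := mem_closure_iff_seq_limit.1 h3
  choose φ hφ using fun n => h2 (v n) (hv n)
  exact ⟨φ, by simpa only [hφ] using hlim⟩

lemma tendsto_energy_iff (F : Factorization f r w) {g : ℝ → Fin T → ℂ} (hg : MemL2 f g)
    (φ : ℕ → SimpleFunc ℝ (Fin T → ℂ)) :
    Tendsto (fun n => energy f (g - ⇑(φ n))) atTop (𝓝 0) ↔
      Tendsto (fun n => embed r (φ n)) atTop (𝓝 (embed r g)) := by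
  have h1 (n) : energy f (g - ⇑(φ n)) = 2 * π * ‖embed r (φ n) - embed r g‖ ^ 2 := by
    rw [norm_sub_rev, ← F.embed_sub hg (F.memL2_simpleFunc _),
      F.norm_embed_sq (F.memL2_sub hg (F.memL2_simpleFunc _)), ← mul_assoc,
      mul_inv_cancel₀ Real.two_pi_pos.ne', one_mul]
  rw [tendsto_iff_norm_sub_tendsto_zero (f := fun n => embed r (φ n))]
  constructor
  · intro h
    have h2 := (h.const_mul (2 * π)⁻¹).sqrt
    simp only [h1, ← mul_assoc, inv_mul_cancel₀ Real.two_pi_pos.ne', one_mul, mul_zero,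
      Real.sqrt_zero, Real.sqrt_sq (norm_nonneg _)] at h2
    exact h2
  · intro h
    simpa [h1] using (h.pow 2).const_mul (2 * π)

lemma simpleIntegral_eq (F : Factorization f r w) {Φ : FreqSpace T →ₗᵢ[ℂ] Lp ℂ 2 P}
    {Z : Set ℝ → Fin T → Lp ℂ 2 P}
    (hZ : ∀ D, MeasurableSet D → D ⊆ Ioc (-π) π → ∀ ν, Z D ν = Φ (embedInd r D ν))
    (φ : SimpleFunc ℝ (Fin T → ℂ)) : simpleIntegral Z φ = Φ (embed r φ) := by
  rw [F.embed_simpleFunc, simpleIntegral]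
  simp only [map_sum, map_smul]
  refine Finset.sum_congr rfl fun b _ => Finset.sum_congr rfl fun ν _ => ?_
  rw [hZ _ ((φ.measurableSet_fiber b).inter measurableSet_Ioc) inter_subset_right]

/-- On simple functions the integral is `Φ`, and `Φ` is continuous, so the limit exists and does not
depend on the approximating sequence. -/
lemma isStochIntegral_iff (F : Factorization f r w) {Φ : FreqSpace T →ₗᵢ[ℂ] Lp ℂ 2 P}
    {Z : Set ℝ → Fin T → Lp ℂ 2 P}
    (hZ : ∀ D, MeasurableSet D → D ⊆ Ioc (-π) π → ∀ ν, Z D ν = Φ (embedInd r D ν))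
    {g : ℝ → Fin T → ℂ} {Y : Lp ℂ 2 P} :
    IsStochIntegral f Z g Y ↔ MemL2 f g ∧ Y = Φ (embed r g) := by
  refine and_congr_right fun hg => ?_
  simp only [F.simpleIntegral_eq hZ, F.tendsto_energy_iff hg]
  constructor
  · rintro ⟨φ, h1, h2⟩
    exact tendsto_nhds_unique h2 ((Φ.continuous.tendsto _).comp h1)
  · rintro rfl
    obtain ⟨φ, hφ⟩ := F.exists_tendsto_simpleFunc (embed r g)
    exact ⟨φ, hφ, (Φ.continuous.tendsto _).comp hφ⟩

lemma exists_spectralIsometry (F : Factorization f r w) (hξ : IsStationarySeq P ξ)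
    (hf : HasSpectralDensity P ξ f) :
    ∃ Φ : FreqSpace T →ₗᵢ[ℂ] Lp ℂ 2 P, ∀ j ν, Φ (embed r (expVec j ν)) =ᵐ[P] ξ j ν := by
  obtain ⟨Φ, hΦ⟩ := exists_linearIsometry (fun q : ℤ × Fin T => embed r (expVec q.1 q.2))
    (fun q => (hξ.memLp q.1 q.2).toLp) (fun p q => by
      rw [F.inner_expVec_expVec, ← hf.covariance, inner_Lp]
      refine integral_congr_ae ?_
      filter_upwards [(hξ.memLp p.1 p.2).coeFn_toLp, (hξ.memLp q.1 q.2).coeFn_toLp] with ω h1 h2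
      rw [h1, h2]) fun u hu => F.eq_zero_of_inner_expVec fun j ν => hu (j, ν)
  refine ⟨Φ, fun j ν => ?_⟩
  rw [hΦ (j, ν)]
  exact MemLp.coeFn_toLp _

variable {Φ : FreqSpace T →ₗᵢ[ℂ] Lp ℂ 2 P}

/-- The hypothesis identifies the adjoint of `Φ` at `X` with `u` by testing on a total family. -/
lemma adjoint_eq_of_inner_expVec (F : Factorization f r w) {X : Lp ℂ 2 P} {u : FreqSpace T}
    (h : ∀ j ν, inner ℂ X (Φ (embed r (expVec j ν))) = inner ℂ u (embed r (expVec j ν)))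
    (v : FreqSpace T) : inner ℂ X (Φ v) = inner ℂ u v := by
  let A := ContinuousLinearMap.adjoint Φ.toContinuousLinearMap
  have hA (v) : inner ℂ (A X) v = inner ℂ X (Φ v) :=
    ContinuousLinearMap.adjoint_inner_left Φ.toContinuousLinearMap v X
  have h0 : A X - u = 0 := F.eq_zero_of_inner_expVec fun j ν => by
    rw [← inner_conj_symm, inner_sub_left, hA, h, sub_self, map_zero]
  rw [← hA, sub_eq_zero.1 h0]

/-- The representation of `ξ` by `Z` shows that the adjoint of `Φ` sends `Z D ν` to the class of the
indicator. As `Φ` need not be onto, the covariance of `Z` is used as well: the two norms agree,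
which forces `Z D ν` into the range of `Φ`. -/
lemma spectralRandomMeasure_eq (F : Factorization f r w)
    (hΦ : ∀ j ν, Φ (embed r (expVec j ν)) =ᵐ[P] ξ j ν) {Z : Set ℝ → Fin T → Lp ℂ 2 P}
    (hZ : IsSpectralRandomMeasure P ξ f Z) (D : Set ℝ) (hD : MeasurableSet D)
    (hs : D ⊆ Ioc (-π) π) (ν : Fin T) : Z D ν = Φ (embedInd r D ν) := by
  have hcov {D'} (hD' : MeasurableSet D') (hs' : D' ⊆ Ioc (-π) π) (μ : Fin T) :
      inner ℂ (Z D ν) (Z D' μ) = inner ℂ (embedInd r D ν) (embedInd r D' μ) := by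
    rw [inner_Lp, hZ.covariance D' D hD' hD hs' hs, F.inner_embedInd_embedInd hD' hD hs']
  have hsimple (φ : SimpleFunc ℝ (Fin T → ℂ)) :
      inner ℂ (Z D ν) (simpleIntegral Z φ) = inner ℂ (embedInd r D ν) (embed r φ) := by
    rw [F.embed_simpleFunc, simpleIntegral]
    simp only [inner_sum, inner_smul_right]
    refine Finset.sum_congr rfl fun b _ => Finset.sum_congr rfl fun μ _ => ?_
    rw [hcov ((φ.measurableSet_fiber b).inter measurableSet_Ioc) inter_subset_right]
  have hall := F.adjoint_eq_of_inner_expVec (Φ := Φ) (X := Z D ν) (u := embedInd r D ν)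
    fun j μ => by
      obtain ⟨X, hX, hg, φ, h1, h2⟩ := hZ.representation j μ
      have hX' : X = Φ (embed r (expVec j μ)) := Lp.ext (hX.trans (hΦ j μ).symm)
      rw [← hX']
      rw [F.tendsto_energy_iff hg] at h1
      have h3 := (tendsto_const_nhds (x := Z D ν)).inner (𝕜 := ℂ) h2
      have h4 := (tendsto_const_nhds (x := embedInd r D ν)).inner (𝕜 := ℂ) h1
      simp only [hsimple] at h3
      exact tendsto_nhds_unique h3 h4
  -- All four terms of the expanded squared norm equal the squared norm of the indicator class.
  rw [← sub_eq_zero, ← inner_self_eq_zero (𝕜 := ℂ), inner_sub_left, inner_sub_right,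
    inner_sub_right, hall, hcov hD hs, LinearIsometry.inner_map_map,
    ← inner_conj_symm (Φ _) (Z D ν), hall, inner_conj_symm]
  ring

lemma isSpectralRandomMeasure [IsFiniteMeasure P] (F : Factorization f r w)
    (hξ : IsStationarySeq P ξ) (hΦ : ∀ j ν, Φ (embed r (expVec j ν)) =ᵐ[P] ξ j ν) :
    IsSpectralRandomMeasure P ξ f fun D ν => Φ (embedInd r D ν) := by
  refine ⟨fun D _ _ ν => ?_, fun D D' hD hD' hs hs' ν μ => ?_, fun j ν => ?_⟩
  -- The mean is the inner product with the constant `1`. It vanishes on every `ξ_ν(j)`, hence on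
  -- the whole range of `Φ`.
  · let one : Lp ℂ 2 P := (memLp_const (1 : ℂ)).toLp _
    have h1 (Y : Lp ℂ 2 P) : inner ℂ one Y = ∫ ω, Y ω ∂P := by
      rw [inner_Lp]
      refine integral_congr_ae ?_
      filter_upwards [(memLp_const (μ := P) (p := 2) (1 : ℂ)).coeFn_toLp] with ω hω
      rw [hω, map_one, mul_one]
    rw [← h1, F.adjoint_eq_of_inner_expVec (Φ := Φ) (u := 0), inner_zero_left]
    intro j ν
    rw [h1, integral_congr_ae (hΦ j ν), hξ.mean_zero, inner_zero_left]
  · rw [← inner_Lp, LinearIsometry.inner_map_map, F.inner_embedInd_embedInd hD hD' hs]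
  · exact ⟨_, hΦ j ν, (F.isStochIntegral_iff fun _ _ _ _ => rfl).2 ⟨F.memL2_expVec j ν, rfl⟩⟩

end Factorization

/-! ### The optimal estimate -/

variable {Φ : FreqSpace T →ₗᵢ[ℂ] Lp ℂ 2 P}

lemma map_mem_observedSpace (hΦ : ∀ j ν, Φ (embed r (expVec j ν)) =ᵐ[P] ξ j ν) {S : Set ℤ}
    {u : FreqSpace T} (hu : u ∈ observedFreq r S) : Φ u ∈ observedSpace P ξ S := by
  have h1 : Submodule.span ℂ {u | ∃ j, j ∉ S ∧ ∃ ν, u = embed r (expVec j ν)} ≤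
      (observedSpace P ξ S).comap Φ.toLinearMap := by
    rw [Submodule.span_le]
    rintro _ ⟨j, hj, ν, rfl⟩
    exact Submodule.le_topologicalClosure _ (Submodule.subset_span ⟨j, hj, ν, hΦ j ν⟩)
  refine Submodule.topologicalClosure_minimal _ h1 ?_ hu
  exact (Submodule.isClosed_topologicalClosure _).preimage Φ.continuous

lemma map_mem_orthogonal_observedSpace (hΦ : ∀ j ν, Φ (embed r (expVec j ν)) =ᵐ[P] ξ j ν)
    {S : Set ℤ} {u : FreqSpace T} (hu : u ∈ (observedFreq r S)ᗮ) :
    Φ u ∈ (observedSpace P ξ S)ᗮ := by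
  rw [mem_orthogonal_observedFreq_iff] at hu
  rw [observedSpace, Submodule.orthogonal_closure, Submodule.mem_orthogonal]
  intro y hy
  induction hy using Submodule.span_induction with
  | mem y hy =>
    obtain ⟨j, hj, ν, hy⟩ := hy
    rw [Lp.ext (hy.trans (hΦ j ν).symm), LinearIsometry.inner_map_map, hu j hj ν]
  | zero => simp
  | add y z _ _ h1 h2 => rw [inner_add_left, h1, h2, add_zero]
  | smul k y _ h1 => rw [inner_smul_left, h1, mul_zero]

/-- By Pythagoras the error of any competitor exceeds that of `Y₀` by its squared distance to `Y₀`.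
-/
lemma isOptimalEstimate_iff {S : Set ℤ} {X Y₀ Y : Lp ℂ 2 P} {X' : Ω → ℂ} (hX : X =ᵐ[P] X')
    (hY₀ : Y₀ ∈ observedSpace P ξ S) (h : X - Y₀ ∈ (observedSpace P ξ S)ᗮ) :
    IsOptimalEstimate P ξ S X' Y ↔ Y = Y₀ := by
  simp only [IsOptimalEstimate, norm_sub_sq_eq_integral X _ hX]
  constructor
  · rintro ⟨h1, h2⟩
    have h3 := h2 Y₀ hY₀
    rw [norm_sub_sq_of_mem_orthogonal hY₀ h h1] at h3
    have h4 : ‖Y₀ - Y‖ ^ 2 = 0 := le_antisymm (by linarith) (by positivity)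
    rw [sq_eq_zero_iff, norm_eq_zero, sub_eq_zero] at h4
    exact h4.symm
  · rintro rfl
    refine ⟨hY₀, fun W hW => ?_⟩
    rw [norm_sub_sq_of_mem_orthogonal hY₀ h hW]
    linarith [sq_nonneg ‖Y - W‖]

lemma Factorization.map_embed_trigPoly_ae_eq (F : Factorization f r w)
    (hΦ : ∀ j ν, Φ (embed r (expVec j ν)) =ᵐ[P] ξ j ν) (s : ℕ) (N K : ℕ → ℕ)
    (a : ℤ → Fin T → ℂ) :
    Φ (embed r (trigPoly (aVec s N K a))) =ᵐ[P] functional s N K a ξ := by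
  rw [(F.embed_trigPoly _).2, map_sum]
  have h1 := Lp.coeFn_fun_finsetSum (μ := P) (p := 2) Finset.univ
    fun q : MissIdx s N K × Fin T => Φ (aVec s N K a q • embed r (expVec q.1.time q.2))
  have h2 : ∀ᵐ ω ∂P, ∀ q : MissIdx s N K × Fin T,
      Φ (aVec s N K a q • embed r (expVec q.1.time q.2)) ω =
        aVec s N K a q * ξ q.1.time q.2 ω := by
    rw [ae_all_iff]
    intro q
    rw [map_smul]
    filter_upwards [Lp.coeFn_smul (aVec s N K a q) (Φ (embed r (expVec q.1.time q.2))),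
      hΦ q.1.time q.2] with ω h3 h4
    rw [h3, Pi.smul_apply, h4, smul_eq_mul]
  filter_upwards [h1, h2] with ω h3 h4
  rw [h3]
  simp only [h4]
  rw [Fintype.sum_prod_type]
  rfl

end Probability

end

end Interp

open Interp
theorem mainTheorem2 {Ω : Type*} [MeasurableSpace Ω] (P : Measure Ω) [IsProbabilityMeasure P]
    (T s : ℕ) (N K : ℕ → ℕ) (hN : N 0 = 0) (hK : K 0 = 0)
    (ξ : ℤ → Fin T → Ω → ℂ) (f : ℝ → Matrix (Fin T) (Fin T) ℂ)
    (hξ : IsStationarySeq P ξ) (hf : HasSpectralDensity P ξ f) (hmin : MinimalityCondition f)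
    (a : ℤ → Fin T → ℂ) :
    -- the matrix `B_s` is invertible, and the components of `c_s = B_s⁻¹ a_s`
    IsUnit (BMat s N K f).det ∧
    (∀ k : MissIdx s N K, (fun ν => cVec s N K f a (k, ν)) =
      ∑ q : MissIdx s N K, CBlock s N K f k q *ᵥ a q.time) ∧
    -- `h` is, up to null sets, the unique minimizer of `Δ(·; f)` over `L₂^{s-}(f)`,
    -- and the minimum is `⟨c_s, a_s⟩`
    specChar s N K f a ∈ L2minus f (missingSet s N K) ∧
    (∀ g ∈ L2minus f (missingSet s N K),
      meanSquareError f (trigPoly (aVec s N K a)) (specChar s N K f a) ≤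
        meanSquareError f (trigPoly (aVec s N K a)) g ∧
      (meanSquareError f (trigPoly (aVec s N K a)) g =
          meanSquareError f (trigPoly (aVec s N K a)) (specChar s N K f a) →
        g =ᵐ[freqMeasure] specChar s N K f a)) ∧
    (meanSquareError f (trigPoly (aVec s N K a)) (specChar s N K f a) : ℂ) =
      cVec s N K f a ⬝ᵥ star (aVec s N K a) ∧
    -- the optimal estimate exists and is unique; the random measure of `ξ` exists
    (∃! Y : Lp ℂ 2 P, IsOptimalEstimate P ξ (missingSet s N K) (functional s N K a ξ) Y) ∧
    (∃ Z : Set ℝ → Fin T → Lp ℂ 2 P, IsSpectralRandomMeasure P ξ f Z) ∧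
    -- the mean square error and the spectral characteristic of the optimal estimate
    (∀ Y : Lp ℂ 2 P, IsOptimalEstimate P ξ (missingSet s N K) (functional s N K a ξ) Y →
      ((∫ ω, ‖functional s N K a ξ ω - Y ω‖ ^ 2 ∂P : ℝ) : ℂ) =
        cVec s N K f a ⬝ᵥ star (aVec s N K a) ∧
      ∀ Z : Set ℝ → Fin T → Lp ℂ 2 P, IsSpectralRandomMeasure P ξ f Z →
        ∀ g : ℝ → Fin T → ℂ, IsSpectralCharacteristic f (missingSet s N K) Z Y g ↔
          g =ᵐ[freqMeasure] specChar s N K f a) := by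
  obtain ⟨r, w, F⟩ := exists_factorization hf.isMatrixDensity hmin
  obtain ⟨Φ, hΦ⟩ := F.exists_spectralIsometry hξ hf
  have hA := (F.embed_trigPoly (aVec s N K a)).1
  have hmem := F.embed_specChar_mem s N K a
  have horth := F.sub_specChar_mem_orthogonal s N K a
  have hh := (F.memL2_specChar s N K a).1
  have hX := F.map_embed_trigPoly_ae_eq hΦ s N K a
  -- `Φ` maps the frequency domain projection to the projection of the functional, so every claim
  -- about the estimate becomes one about `specChar`.
  have hopt (Y : Lp ℂ 2 P) :
      IsOptimalEstimate P ξ (missingSet s N K) (functional s N K a ξ) Y ↔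
        Y = Φ (embed r (specChar s N K f a)) :=
    isOptimalEstimate_iff hX (map_mem_observedSpace hΦ hmem)
      (by rw [← map_sub]; exact map_mem_orthogonal_observedSpace hΦ horth)
  refine ⟨F.isUnit_det_BMat s N K, fun k => ?_, F.specChar_mem_L2minus s N K a, fun g hg => ?_, ?_,
    ⟨_, (hopt _).2 rfl, fun Y hY => (hopt Y).1 hY⟩, ⟨_, F.isSpectralRandomMeasure hξ hΦ⟩,
    fun Y hY => ⟨?_, fun Z hZ g => ?_⟩⟩
  · ext ν
    simp only [cVec, Matrix.mulVec, dotProduct, Finset.sum_apply, CBlock, Matrix.of_apply, aVec]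
    rw [Fintype.sum_prod_type]
  · obtain ⟨hg1, hg2⟩ := F.mem_L2minus_iff.1 hg
    rw [F.meanSquareError_eq hA hg1, F.meanSquareError_eq hA hh,
      norm_sub_sq_of_mem_orthogonal hmem horth hg2]
    refine ⟨by linarith [sq_nonneg ‖embed r (specChar s N K f a) - embed r g‖], fun h => ?_⟩
    rw [add_eq_left, sq_eq_zero_iff, norm_eq_zero, sub_eq_zero, F.embed_eq_iff hh hg1] at h
    exact h.symm
  · rw [F.meanSquareError_eq hA hh, F.norm_sub_specChar_sq]
  · rw [(hopt Y).1 hY, norm_sub_sq_eq_integral _ _ hX, ← map_sub, LinearIsometry.norm_map,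
      F.norm_sub_specChar_sq]
  -- For an arbitrary `Z`, integration is `Φ ∘ embed r`; injectivity of both maps, the second up to
  -- null sets, identifies `g`.
  · rw [IsSpectralCharacteristic, F.mem_L2minus_iff,
      F.isStochIntegral_iff (F.spectralRandomMeasure_eq hΦ hZ), (hopt Y).1 hY]
    constructor
    · rintro ⟨-, hg, h⟩
      exact ((F.embed_eq_iff hh hg).1 (Φ.injective h)).symm
    · intro h
      have hg : MemL2 f g := hh.congr_ae h.symm
      have h' : embed r g = embed r (specChar s N K f a) := (F.embed_eq_iff hg hh).2 h
      exact ⟨⟨hg, h' ▸ hmem⟩, hg, by rw [h']⟩
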